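/- **Boundedness implies convergence.** Fix integers $n,r,s\ge 0$. There are functions $H_k=H_k(a_1,\dots,a_{k+2};b;h)$, $k=0,1,2,\dots$ (depending only on $n,r,s,k$), which assign to positive numbers $a_1,\dots,a_{k+2}$, a real number $b$ and a positive function $h:\mathbb R\to(0,\infty)$ with $h(t)\to0$ as $t\to\infty$ a positive function $t\mapsto H_k(a_1,\dots,a_{k+2};b;h)(t)$ on $\mathbb R$ which tends to $0$ as $t\to\infty$, such that the following holds. Let $X$ be a smooth $n$-dimensional manifold (not necessarily compact), $U\subset X$ an open subset, $\tilde g(t)$, $t\in\mathbb R$, a family of smooth Riemannian metrics on $X$ (not necessarily complete), and $\eta(t)$, $t\in\mathbb R$, a family of smooth tensor fields of type $(r,s)$ on $X$ (smooth functions if $r=s=0$); no regularity in $t$ is assumed. For a subset $S\subset X$ write $\|\eta\|_{C^k(S,g)}=\sum_{j=0}^{k}\sup_{S}|\nabla^{j,g}\eta|_g$, where $\nabla^{j,g}\eta$ is the $j$-th iterated covariant derivative with respect to the Levi-Civita connection of $g$. Suppose that there are positive constants $A_1,A_2,\dots$, a positive function $h_0$ on $\mathbb R$ with $h_0(t)\to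 0$ as $t\to\infty$, and constants $B_K$ for the compact subsets $K\subset U$, such that (A) $\|\eta(t)\|_{C^0(U,\tilde g(t))}\le h_0(t)$ for all $t\in\mathbb R$; (B) $\|\eta(t)\|_{C^k(U,\tilde g(t))}\le A_k$ for all $k\ge 1$ and all $t\in\mathbb R$; (C) for every compact subset $K\subset U$ there is a smooth function $\rho:X\to[0,1]$, independent of $t$, whose support $\hat K$ is a compact subset of $U$, with $\rho\equiv1$ in a neighbourhood of $K$ and $$|\nabla\rho|^2_{\tilde g(t)}+|\Delta_{\tilde g(t)}\rho|\le B_K\qquad\text{on }\hat K\times[0,\infty),$$ where $\Delta_{\tilde g(t)}$ is the Laplace-Beltrami operator. Then for every compact subset $K\subset U$, every $k\ge0$ and every $t\in\mathbb R$, $$\|\eta(t)\|_{C^k(K,\tilde g(t))}\le h_{K,k}(t):=H_k(A_1,\dots,A_{k+2};B_K;h_0)(t).$$ In particular $\|\eta(t)\|_{C^k(K,\tilde g(t))}\to0$ as $t\to\infty$. -/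

import Mathlib

open scoped Manifold ContDiff Topology ENNReal

universe u

noncomputable section

namespace BIC

/-- The model space `ℝⁿ`. -/
abbrev Model (n : ℕ) : Type := EuclideanSpace ℝ (Fin n)

/-- Arrays of real components with `r` upper and `s` lower indices in dimension `n`, depending on
a point of the coordinate space `ℝⁿ`. -/
abbrev CompField (n r s : ℕ) : Type := Model n → (Fin r → Fin n) → (Fin s → Fin n) → ℝ

/-- The coordinate partial derivative `∂ᵢ f` of a function on (an open subset of) `ℝⁿ`. -/
def pderiv {n : ℕ} (i : Fin n) (f : Model n → ℝ) (y : Model n) : ℝ :=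
  fderiv ℝ f y (EuclideanSpace.single i 1)

section Manifold

variable {n : ℕ} {X : Type*} [TopologicalSpace X] [ChartedSpace (Model n) X]

/-! ### Coordinate frames and smooth tensor fields -/

/-- The coordinate vector `∂/∂xⁱ` of the chart `φ` at the point with coordinates `y`. -/
def coordVec (φ : OpenPartialHomeomorph X (Model n)) (i : Fin n) (y : Model n) :
    TangentSpace (𝓡 n) (φ.symm y) :=
  mfderiv (𝓡 n) (𝓡 n) φ.symm y (EuclideanSpace.single i 1 : Model n)

/-- The coordinate covector `dxⁱ` of the chart `φ` at the point with coordinates `y`. -/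
def coordCovec (φ : OpenPartialHomeomorph X (Model n)) (i : Fin n) (y : Model n) :
    TangentSpace (𝓡 n) (φ.symm y) →L[ℝ] ℝ :=
  (EuclideanSpace.proj i : Model n →L[ℝ] ℝ).comp
    (mfderiv (𝓡 n) (𝓡 n) φ (φ.symm y) : TangentSpace (𝓡 n) (φ.symm y) →L[ℝ] Model n)

/-- Tensors of type `(r, s)` at `x`: multilinear functions of `r` covectors and `s` vectors. -/
abbrev TensorAt (n : ℕ) {X : Type*} [TopologicalSpace X] [ChartedSpace (Model n) X]
    (r s : ℕ) (x : X) : Type _ :=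
  MultilinearMap ℝ (fun _ : Fin r => TangentSpace (𝓡 n) x →L[ℝ] ℝ)
    (MultilinearMap ℝ (fun _ : Fin s => TangentSpace (𝓡 n) x) ℝ)

/-- The components `T^{i₁…i_r}_{j₁…j_s} = T(dx^{i₁}, …, dx^{i_r}, ∂_{j₁}, …, ∂_{j_s})` of a
field of tensors in the chart `φ`, as functions of the coordinates. -/
def tensorComp {r s : ℕ} (φ : OpenPartialHomeomorph X (Model n))
    (T : ∀ x : X, TensorAt n r s x) : CompField n r s :=
  fun y I J => T (φ.symm y) (fun a => coordCovec φ (I a) y) (fun b => coordVec φ (J b) y)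

variable (n X) in
/-- Smooth tensor fields of type `(r, s)`: in every chart of the atlas the components are smooth
functions of the coordinates. For `r = s = 0` these are the smooth functions. -/
structure SmoothTensorField (r s : ℕ) where
  /-- The value at a point. -/
  toFun : ∀ x : X, TensorAt n r s x
  smooth : ∀ φ ∈ atlas (Model n) X, ∀ I J,
    ContDiffOn ℝ ∞ (fun y => tensorComp φ toFun y I J) φ.target

variable [IsManifold (𝓡 n) ∞ X]

variable (n X) in
/-- Smooth Riemannian metrics on `X`. -/
abbrev Metric : Type _ :=
  Bundle.ContMDiffRiemannianMetric (𝓡 n) ∞ (Model n) (fun x : X => TangentSpace (𝓡 n) x)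

/-! ### Levi-Civita covariant derivatives, norms, gradient and Laplacian in a chart -/

section Chart

variable (φ : OpenPartialHomeomorph X (Model n)) (g : Metric n X)

/-- The matrix `g_{ij} = g(∂ᵢ, ∂ⱼ)` of the metric. -/
def gram (y : Model n) : Matrix (Fin n) (Fin n) ℝ :=
  Matrix.of fun i j => g.inner (φ.symm y) (coordVec φ i y) (coordVec φ j y)

/-- The inverse matrix `g^{ij}`. -/
def gramInv (y : Model n) : Matrix (Fin n) (Fin n) ℝ := (gram φ g y)⁻¹

/-- The Christoffel symbols
`Γᵏᵢⱼ = ½ ∑ₗ g^{kl} (∂ᵢ g_{jl} + ∂ⱼ g_{il} - ∂ₗ g_{ij})`. -/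
def christoffel (k i j : Fin n) (y : Model n) : ℝ :=
  (1 / 2 : ℝ) * ∑ l, gramInv φ g y k l *
    (pderiv i (fun z => gram φ g z j l) y + pderiv j (fun z => gram φ g z i l) y
      - pderiv l (fun z => gram φ g z i j) y)

/-- The components of the Levi-Civita covariant derivative of an `(r, s)`-tensor field with
components `T`. The direction of differentiation is the first lower index: for `m = J 0` and
`j = (j₁, …, j_s) = Fin.tail J`,
`(∇T)^{i₁…}_{m j₁…} = ∂ₘ T^{i₁…}_{j₁…} + ∑ₐ ∑ₗ Γ^{iₐ}_{m l} T^{…l…}_{j₁…}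
  - ∑_b ∑ₗ Γˡ_{m j_b} T^{i₁…}_{…l…}`. -/
def covDeriv {r s : ℕ} (T : CompField n r s) : CompField n r (s + 1) :=
  fun y I J =>
    pderiv (J 0) (fun z => T z I (Fin.tail J)) y
    + ∑ a : Fin r, ∑ l : Fin n,
        christoffel φ g (I a) (J 0) l y * T y (Function.update I a l) (Fin.tail J)
    - ∑ b : Fin s, ∑ l : Fin n,
        christoffel φ g l (J 0) (Fin.tail J b) y * T y I (Function.update (Fin.tail J) b l)

/-- The components of the iterated covariant derivative `∇ᵏT`. -/
def iterCovDeriv {r s : ℕ} (T : CompField n r s) : (k : ℕ) → CompField n r (s + k)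
  | 0 => T
  | k + 1 => covDeriv φ g (iterCovDeriv T k)

/-- The squared norm of an `(r, s)`-tensor field with components `T`:
`|T|² = g_{i₁i'₁} ⋯ g_{i_r i'_r} g^{j₁j'₁} ⋯ g^{j_s j'_s} T^{i₁…i_r}_{j₁…j_s}
T^{i'₁…i'_r}_{j'₁…j'_s}`. -/
def compNormSq {r s : ℕ} (T : CompField n r s) (y : Model n) : ℝ :=
  ∑ I : Fin r → Fin n, ∑ I' : Fin r → Fin n, ∑ J : Fin s → Fin n, ∑ J' : Fin s → Fin n,
    (∏ a, gram φ g y (I a) (I' a)) * (∏ b, gramInv φ g y (J b) (J' b)) * T y I J * T y I' J'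

/-- `|∇f|² = g^{ij} ∂ᵢf ∂ⱼf`, for a function `f` of the coordinates. -/
def compGradNormSq (f : Model n → ℝ) (y : Model n) : ℝ :=
  ∑ i, ∑ j, gramInv φ g y i j * pderiv i f y * pderiv j f y

/-- `Δf = g^{ij} (∂ᵢ∂ⱼf - Γᵏᵢⱼ ∂ₖf)`, for a function `f` of the coordinates. -/
def compLaplacian (f : Model n → ℝ) (y : Model n) : ℝ :=
  ∑ i, ∑ j, gramInv φ g y i j *
    (pderiv i (pderiv j f) y - ∑ k, christoffel φ g k i j y * pderiv k f y)

end Chart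

/-! ### Invariant quantities

The quantities below do not depend on coordinates; at the point `x` they are evaluated in the
preferred chart at `x`. -/

/-- The pointwise norm `|∇ᵏη|_g (x)`, where `∇` is the Levi-Civita connection of `g`. -/
def covDerivNorm {r s : ℕ} (g : Metric n X) (η : SmoothTensorField n X r s) (k : ℕ) (x : X) : ℝ :=
  √(compNormSq (chartAt (Model n) x) g
      (iterCovDeriv (chartAt (Model n) x) g (tensorComp (chartAt (Model n) x) η.toFun) k)
      (chartAt (Model n) x x))

/-- The norm `‖η‖_{C^k(S, g)} = ∑_{j ≤ k} sup_S |∇ʲη|_g`, with values in `[0, ∞]`. -/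
def ckNorm {r s : ℕ} (k : ℕ) (S : Set X) (g : Metric n X) (η : SmoothTensorField n X r s) :
    ℝ≥0∞ :=
  ∑ j ∈ Finset.range (k + 1), ⨆ x ∈ S, ENNReal.ofReal (covDerivNorm g η j x)

/-- The squared norm `|∇f|²_g (x)` of the gradient. -/
def gradNormSq (g : Metric n X) (f : X → ℝ) (x : X) : ℝ :=
  compGradNormSq (chartAt (Model n) x) g (f ∘ (chartAt (Model n) x).symm)
    (chartAt (Model n) x x)

/-- The Laplace-Beltrami operator `Δ_g f (x)`. -/
def laplacian (g : Metric n X) (f : X → ℝ) (x : X) : ℝ :=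
  compLaplacian (chartAt (Model n) x) g (f ∘ (chartAt (Model n) x).symm)
    (chartAt (Model n) x x)

end Manifold

/-- `ρ` is a smooth cut-off function for `K` in `U`: `0 ≤ ρ ≤ 1`, the support of `ρ` is a compact
subset of `U`, and `ρ = 1` in a neighbourhood of `K`. -/
structure IsCutoff {n : ℕ} {X : Type*} [TopologicalSpace X] [ChartedSpace (Model n) X]
    (K U : Set X) (ρ : X → ℝ) : Prop where
  smooth : ContMDiff (𝓡 n) 𝓘(ℝ, ℝ) ∞ ρ
  compact : HasCompactSupport ρ
  subset : tsupport ρ ⊆ U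
  nonneg : ∀ x, 0 ≤ ρ x
  le_one : ∀ x, ρ x ≤ 1
  eq_one : ∀ᶠ x in 𝓝ˢ K, ρ x = 1

end BIC

end

/-! Everything happens at one fixed time `t`, so no regularity in `t` is needed. Smallness passes
from `∇ʲη` to `∇^{j+1}η` by a maximum principle. Suppose that on the support of `ρ` one has `ρ^j
|∇ʲη| ≤ δ` and that the derivatives up to order `j + 3` are at most `M`. Bochner's formula gives
`Δ|∇ʲη|² ≥ 2|∇^{j+1}η|² - 2√n |∇^{j+2}η| |∇ʲη|` (`le_compLaplacian_compNormSq`). The second-order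
term is merely estimated: derivatives are never commuted, so no curvature enters.

Let `F = ρ^{2j+2} (|∇^{j+1}η|² + (M/δ) |∇ʲη|²)`. Where `F` is maximal and `ρ ≠ 0`, `ΔF ≤ 0`. The
good term `2 (M/δ) ρ^{2j+2} |∇^{j+1}η|²` is then controlled by errors of size `M²`: those carrying
the large factor `M/δ` also contain `ρ^j |∇ʲη| ≤ δ` (`interpolation_arith`, `bound_of_isLocalMax`).
Hence `F ≤ C M δ` and `ρ^{j+1} |∇^{j+1}η| ≤ √(C M δ)` (`interpolation_step`). Starting from `δ =
h₀(t)` and iterating with the same `ρ` gives bounds that tend to zero like iterated square roots of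
`h₀`. Compactness of the support replaces completeness, and reaching order `k` uses derivatives up
to order `k + 2`.

The norms are defined pointwise in the preferred chart of each point, so differentiating them first
requires chart independence (`covDerivNorm_eq`). For this, tensor components are flattened to
vectors on which chart changes act by Kronecker products. The transformation law of the Christoffel
symbols (`jac_mul_connMatrix`) is deduced from the uniqueness of the Levi-Civita connection. -/

set_option linter.unusedSectionVars false

noncomputable section

namespace BIC

/-! ### Kronecker products of families of matrices -/

section Kron

variable {ι κ : Type*} [Fintype ι] [DecidableEq ι] [Fintype κ] [DecidableEq κ]

/-- The Kronecker product of a family of square matrices, indexed by multi-indices. -/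
def kron {ι κ : Type*} [Fintype ι] (S : ι → Matrix κ κ ℝ) : Matrix (ι → κ) (ι → κ) ℝ :=
  Matrix.of fun I J => ∏ a, S a (I a) (J a)

/-- The derivative of `kron` at `S` in the direction `S'`. -/
def kronDeriv {ι κ : Type*} [Fintype ι] [DecidableEq ι] (S S' : ι → Matrix κ κ ℝ) :
    Matrix (ι → κ) (ι → κ) ℝ :=
  ∑ a, kron (Function.update S a (S' a))

theorem kron_apply {ι κ : Type*} [Fintype ι] (S : ι → Matrix κ κ ℝ) (I J : ι → κ) :
    kron S I J = ∏ a, S a (I a) (J a) := rfl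

/-- Expanding a product of sums turns one contraction per slot into a single sum over multi-indices.
-/
theorem kron_mul (S R : ι → Matrix κ κ ℝ) :
    kron (fun a => S a * R a) = kron S * kron R := by
  ext I J
  simp only [kron_apply, Matrix.mul_apply]
  rw [Finset.prod_univ_sum, Fintype.piFinset_univ]
  exact Finset.sum_congr rfl fun L _ => Finset.prod_mul_distrib

theorem kron_transpose {ι κ : Type*} [Fintype ι] (S : ι → Matrix κ κ ℝ) :
    kron (fun a => (S a).transpose) = (kron S).transpose := rfl

theorem kron_mul_kronDeriv (R S S' : ι → Matrix κ κ ℝ) :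
    kron R * kronDeriv S S' = kronDeriv (fun a => R a * S a) (fun a => R a * S' a) := by
  simp only [kronDeriv, Finset.mul_sum, ← kron_mul]
  refine Finset.sum_congr rfl fun a _ => congrArg kron (funext fun b => ?_)
  rcases eq_or_ne b a with rfl | h <;> simp [*]

theorem kronDeriv_mul_kron (R S S' : ι → Matrix κ κ ℝ) :
    kronDeriv S S' * kron R = kronDeriv (fun a => S a * R a) (fun a => S' a * R a) := by
  simp only [kronDeriv, Finset.sum_mul, ← kron_mul]
  refine Finset.sum_congr rfl fun a _ => congrArg kron (funext fun b => ?_)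
  rcases eq_or_ne b a with rfl | h <;> simp [*]

theorem kronDeriv_apply {ι κ : Type*} [Fintype ι] [DecidableEq ι] (S S' : ι → Matrix κ κ ℝ)
    (I J : ι → κ) :
    kronDeriv S S' I J
      = ∑ a, S' a (I a) (J a) * ∏ b ∈ Finset.univ.erase a, S b (I b) (J b) := by
  simp only [kronDeriv, Matrix.sum_apply, kron_apply]
  refine Finset.sum_congr rfl fun a _ => ?_
  rw [← Finset.mul_prod_erase _ _ (Finset.mem_univ a), Function.update_self]
  congr 1
  refine Finset.prod_congr rfl fun b hb => ?_
  rw [Function.update_of_ne (Finset.ne_of_mem_erase hb)]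

theorem kronDeriv_add {ι κ : Type*} [Fintype ι] [DecidableEq ι] (S S' S'' : ι → Matrix κ κ ℝ) :
    kronDeriv S (fun a => S' a + S'' a) = kronDeriv S S' + kronDeriv S S'' := by
  ext I J
  simp only [kronDeriv_apply, Matrix.add_apply, add_mul, Finset.sum_add_distrib]

theorem kronDeriv_sum {ι κ α : Type*} [Fintype ι] [DecidableEq ι] [Fintype α]
    (S : ι → Matrix κ κ ℝ) (c : α → ℝ) (S' : α → ι → Matrix κ κ ℝ) :
    kronDeriv S (fun a => ∑ i, c i • S' i a) = ∑ i, c i • kronDeriv S (S' i) := by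
  ext I J
  simp only [kronDeriv_apply, Matrix.sum_apply, Matrix.smul_apply, smul_eq_mul, Finset.mul_sum,
    Finset.sum_mul]
  rw [Finset.sum_comm]
  simp only [mul_assoc]

theorem kronDeriv_one_transpose (S : ι → Matrix κ κ ℝ) :
    kronDeriv (fun _ => 1) (fun a => (S a).transpose)
      = (kronDeriv (fun _ => 1) S).transpose := by
  ext I J
  simp only [kronDeriv_apply, Matrix.transpose_apply, Matrix.one_apply]
  simp only [eq_comm]

/-- `kronDeriv 1 S` acts on one index at a time. -/
theorem kronDeriv_one_mulVec (S : ι → Matrix κ κ ℝ) (v : (ι → κ) → ℝ) (I : ι → κ) :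
    (kronDeriv (fun _ => 1) S).mulVec v I
      = ∑ a, ∑ l, S a (I a) l * v (Function.update I a l) := by
  simp only [Matrix.mulVec, dotProduct, kronDeriv_apply, Finset.sum_mul]
  rw [Finset.sum_comm]
  refine Finset.sum_congr rfl fun a _ => ?_
  -- The product of Kronecker deltas vanishes unless `J` agrees with `I` off the slot `a`. Writing
  -- the term as a sum of indicators over the new entry `l` allows the sum over `J` to be done
  -- first.
  have key : ∀ J : ι → κ, (S a (I a) (J a) * ∏ b ∈ Finset.univ.erase a,
      (1 : Matrix κ κ ℝ) (I b) (J b)) * v J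
      = ∑ l, if J = Function.update I a l then S a (I a) l * v (Function.update I a l) else 0 := by
    intro J
    by_cases h : ∀ b, b ≠ a → I b = J b
    · have hJ : J = Function.update I a (J a) := by
        ext b
        rcases eq_or_ne b a with rfl | hb
        · simp
        · simp [hb, h b hb]
      rw [Finset.sum_eq_single (J a), if_pos hJ, ← hJ, Finset.prod_eq_one, mul_one]
      · intro b hb
        rw [h b (Finset.ne_of_mem_erase hb), Matrix.one_apply_eq]
      · intro l _ hl
        rw [if_neg]
        intro h'
        exact hl (by rw [h', Function.update_self])
      · simp
    · push Not at h
      obtain ⟨b, hb, hb'⟩ := h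
      have h0 : ∏ b ∈ Finset.univ.erase a, (1 : Matrix κ κ ℝ) (I b) (J b) = 0 :=
        Finset.prod_eq_zero (i := b) (Finset.mem_erase.2 ⟨hb, Finset.mem_univ b⟩)
          (Matrix.one_apply_ne hb')
      rw [h0, mul_zero, zero_mul, Finset.sum_eq_zero]
      intro l _
      rw [if_neg]
      intro h'
      exact hb' (by rw [h', Function.update_of_ne hb])
  rw [Finset.sum_congr rfl fun J _ => key J, Finset.sum_comm]
  simp

end Kron

/-! ### Coordinate derivatives -/

section Calculus

variable {n : ℕ} {f g : Model n → ℝ} {y : Model n} {O : Set (Model n)}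

theorem pderiv_congr (i : Fin n) (h : f =ᶠ[𝓝 y] g) : pderiv i f y = pderiv i g y := by
  rw [pderiv, pderiv, h.fderiv_eq]

theorem pderiv_mul (i : Fin n) (hf : DifferentiableAt ℝ f y) (hg : DifferentiableAt ℝ g y) :
    pderiv i (fun z => f z * g z) y = pderiv i f y * g y + f y * pderiv i g y := by
  simp only [pderiv]
  rw [fderiv_fun_mul hf hg]
  simp
  ring

theorem pderiv_add (i : Fin n) (hf : DifferentiableAt ℝ f y) (hg : DifferentiableAt ℝ g y) :
    pderiv i (fun z => f z + g z) y = pderiv i f y + pderiv i g y := by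
  simp only [pderiv]
  rw [fderiv_fun_add hf hg]
  simp

theorem pderiv_const_mul (i : Fin n) (c : ℝ) (hf : DifferentiableAt ℝ f y) :
    pderiv i (fun z => c * f z) y = c * pderiv i f y := by
  simp only [pderiv]
  rw [fderiv_const_mul hf]
  simp

theorem pderiv_const (i : Fin n) (c : ℝ) : pderiv i (fun _ : Model n => c) y = 0 := by
  simp [pderiv]

theorem pderiv_sum {α : Type*} (t : Finset α) (i : Fin n) {F : α → Model n → ℝ}
    (hF : ∀ a ∈ t, DifferentiableAt ℝ (F a) y) :
    pderiv i (fun z => ∑ a ∈ t, F a z) y = ∑ a ∈ t, pderiv i (F a) y := by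
  simp only [pderiv]
  rw [fderiv_fun_sum hF]
  simp

theorem pderiv_prod {α : Type*} [DecidableEq α] (t : Finset α) (i : Fin n) {F : α → Model n → ℝ}
    (hF : ∀ a ∈ t, DifferentiableAt ℝ (F a) y) :
    pderiv i (fun z => ∏ a ∈ t, F a z) y
      = ∑ a ∈ t, pderiv i (F a) y * ∏ b ∈ t.erase a, F b y := by
  simp only [pderiv]
  rw [fderiv_finsetProd hF]
  simp [mul_comm]

theorem pderiv_pow (i : Fin n) (m : ℕ) (hf : DifferentiableAt ℝ f y) :
    pderiv i (fun z => f z ^ m) y = m * f y ^ (m - 1) * pderiv i f y := by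
  simp only [pderiv]
  rw [fderiv_fun_pow m hf]
  simp

theorem contDiffOn_pderiv (hO : IsOpen O) (hf : ContDiffOn ℝ ∞ f O) (i : Fin n) :
    ContDiffOn ℝ ∞ (pderiv i f) O :=
  (hf.fderiv_of_isOpen hO (by simp)).clm_apply contDiffOn_const

theorem differentiableAt_of_contDiffOn (hO : IsOpen O) (hf : ContDiffOn ℝ ∞ f O) (hy : y ∈ O) :
    DifferentiableAt ℝ f y :=
  ((hf y hy).contDiffAt (hO.mem_nhds hy)).differentiableAt (by simp)

theorem pderiv_comm (hO : IsOpen O) (hf : ContDiffOn ℝ ∞ f O) (hy : y ∈ O) (i j : Fin n) :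
    pderiv i (pderiv j f) y = pderiv j (pderiv i f) y := by
  have hc : ContDiffAt ℝ ∞ f y := (hf y hy).contDiffAt (hO.mem_nhds hy)
  have hs : IsSymmSndFDerivAt ℝ f y := hc.isSymmSndFDerivAt (by
    rw [minSmoothness_of_isRCLikeNormedField]
    exact WithTop.coe_le_coe.2 (le_top : (2 : ℕ∞) ≤ ⊤))
  have hd : DifferentiableAt ℝ (fderiv ℝ f) y :=
    (hc.fderiv_right (m := 1) (by norm_cast)).differentiableAt (by simp)
  have key : ∀ v w : Model n, 
      fderiv ℝ (fun z => fderiv ℝ f z v) y w = fderiv ℝ (fderiv ℝ f) y w v := by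
    intro v w
    rw [fderiv_clm_apply hd (differentiableAt_const v)]
    simp
  change fderiv ℝ (fun z => fderiv ℝ f z _) y _ = fderiv ℝ (fun z => fderiv ℝ f z _) y _
  rw [key, key]
  exact hs.eq _ _

/-- The chain rule for coordinate derivatives. -/
theorem pderiv_comp {m : ℕ} (i : Fin n) {F : Model m → ℝ} {τ : Model n → Model m}
    (hF : DifferentiableAt ℝ F (τ y)) (hτ : DifferentiableAt ℝ τ y) :
    pderiv i (fun z => F (τ z)) y = ∑ k, pderiv i (fun z => τ z k) y * pderiv k F (τ y) := by
  have h1 : ∀ k, pderiv i (fun z => τ z k) y = (fderiv ℝ τ y (EuclideanSpace.single i 1)) k := by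
    intro k
    have : HasFDerivAt (fun z => τ z k)
        ((EuclideanSpace.proj k : Model m →L[ℝ] ℝ).comp (fderiv ℝ τ y)) y :=
      (EuclideanSpace.proj k : Model m →L[ℝ] ℝ).hasFDerivAt.comp y hτ.hasFDerivAt
    rw [pderiv, this.fderiv]
    rfl
  have h2 : ∀ v : Model m, v = ∑ k, v k • (EuclideanSpace.single k 1 : Model m) := by
    intro v
    ext j
    simp [Finset.sum_apply, Pi.single_apply]
  rw [pderiv, show (fun z => F (τ z)) = F ∘ τ from rfl, fderiv_comp y hF hτ,
    ContinuousLinearMap.comp_apply, h2 (fderiv ℝ τ y _), map_sum]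
  refine Finset.sum_congr rfl fun k _ => ?_
  rw [map_smul, h1, smul_eq_mul, pderiv]

/-- The entrywise coordinate derivative of a matrix of functions. -/
def mderiv {α β : Type*} (i : Fin n) (A : Model n → Matrix α β ℝ) (y : Model n) : Matrix α β ℝ :=
  Matrix.of fun a b => pderiv i (fun z => A z a b) y

/-- The componentwise coordinate derivative of a vector of functions. -/
def vderiv {α : Type*} (i : Fin n) (v : Model n → α → ℝ) (y : Model n) : α → ℝ :=
  fun a => pderiv i (fun z => v z a) y

theorem mderiv_mul {α β γ : Type*} [Fintype β] (i : Fin n) {A : Model n → Matrix α β ℝ}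
    {B : Model n → Matrix β γ ℝ} (hA : ∀ a b, DifferentiableAt ℝ (fun z => A z a b) y)
    (hB : ∀ a b, DifferentiableAt ℝ (fun z => B z a b) y) :
    mderiv i (fun z => A z * B z) y = mderiv i A y * B y + A y * mderiv i B y := by
  ext a c
  simp only [mderiv, Matrix.of_apply, Matrix.mul_apply, Matrix.add_apply]
  rw [pderiv_sum _ _ fun b _ => (hA a b).fun_mul (hB b c), ← Finset.sum_add_distrib]
  exact Finset.sum_congr rfl fun b _ => pderiv_mul i (hA a b) (hB b c)

theorem vderiv_mulVec {α β : Type*} [Fintype β] (i : Fin n) {A : Model n → Matrix α β ℝ}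
    {v : Model n → β → ℝ} (hA : ∀ a b, DifferentiableAt ℝ (fun z => A z a b) y)
    (hv : ∀ b, DifferentiableAt ℝ (fun z => v z b) y) :
    vderiv i (fun z => (A z).mulVec (v z)) y
      = (mderiv i A y).mulVec (v y) + (A y).mulVec (vderiv i v y) := by
  ext a
  simp only [mderiv, vderiv, Matrix.mulVec, dotProduct, Matrix.of_apply, Pi.add_apply]
  rw [pderiv_sum _ _ fun b _ => (hA a b).fun_mul (hv b), ← Finset.sum_add_distrib]
  exact Finset.sum_congr rfl fun b _ => pderiv_mul i (hA a b) (hv b)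

theorem pderiv_dotProduct {α : Type*} [Fintype α] (i : Fin n) {v w : Model n → α → ℝ}
    (hv : ∀ b, DifferentiableAt ℝ (fun z => v z b) y)
    (hw : ∀ b, DifferentiableAt ℝ (fun z => w z b) y) :
    pderiv i (fun z => v z ⬝ᵥ w z) y = vderiv i v y ⬝ᵥ w y + v y ⬝ᵥ vderiv i w y := by
  simp only [vderiv, dotProduct]
  rw [pderiv_sum _ _ fun b _ => (hv b).fun_mul (hw b), ← Finset.sum_add_distrib]
  exact Finset.sum_congr rfl fun b _ => pderiv_mul i (hv b) (hw b)

theorem mderiv_kron {ι κ : Type*} [Fintype ι] [DecidableEq ι] (i : Fin n)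
    {S : ι → Model n → Matrix κ κ ℝ}
    (hS : ∀ a j k, DifferentiableAt ℝ (fun z => S a z j k) y) :
    mderiv i (fun z => kron fun a => S a z) y
      = kronDeriv (fun a => S a y) (fun a => mderiv i (S a) y) := by
  ext I J
  rw [kronDeriv_apply]
  simp only [mderiv, Matrix.of_apply, kron_apply]
  exact pderiv_prod _ _ fun a _ => hS a _ _

theorem differentiableAt_kron {ι κ : Type*} [Fintype ι] {S : ι → Model n → Matrix κ κ ℝ}
    (hS : ∀ a j k, DifferentiableAt ℝ (fun z => S a z j k) y) (I J : ι → κ) :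
    DifferentiableAt ℝ (fun z => kron (fun a => S a z) I J) y := by
  simp only [kron_apply]
  classical
  exact (HasFDerivAt.finsetProd fun a _ => (hS a (I a) (J a)).hasFDerivAt).differentiableAt

theorem differentiableAt_mulVec {α β : Type*} [Fintype β] {A : Model n → Matrix α β ℝ}
    {v : Model n → β → ℝ} (hA : ∀ a b, DifferentiableAt ℝ (fun z => A z a b) y)
    (hv : ∀ b, DifferentiableAt ℝ (fun z => v z b) y) (a : α) :
    DifferentiableAt ℝ (fun z => (A z).mulVec (v z) a) y := by
  simp only [Matrix.mulVec, dotProduct]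
  exact DifferentiableAt.fun_sum fun b _ => (hA a b).fun_mul (hv b)

end Calculus

/-! ### Changes of charts -/

section Charts

variable {n : ℕ} {X : Type*} [TopologicalSpace X] [ChartedSpace (Model n) X]

/-- The coordinate change between two charts. -/
def trans (φ φ' : OpenPartialHomeomorph X (Model n)) (y : Model n) : Model n := φ' (φ.symm y)

/-- The domain of the coordinate change between two charts. -/
def overlap (φ φ' : OpenPartialHomeomorph X (Model n)) : Set (Model n) :=
  φ.target ∩ φ.symm ⁻¹' φ'.source

/-- The Jacobian matrix of a coordinate change. -/
def jac (φ φ' : OpenPartialHomeomorph X (Model n)) (y : Model n) : Matrix (Fin n) (Fin n) ℝ :=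
  Matrix.of fun k i => pderiv i (fun z => trans φ φ' z k) y

variable {φ φ' : OpenPartialHomeomorph X (Model n)} {y : Model n}

theorem isOpen_overlap (φ φ' : OpenPartialHomeomorph X (Model n)) : IsOpen (overlap φ φ') :=
  φ.symm.isOpen_inter_preimage φ'.open_source

theorem trans_mem_target (hy : y ∈ overlap φ φ') : trans φ φ' y ∈ φ'.target :=
  φ'.map_source hy.2

theorem symm_trans (hy : y ∈ overlap φ φ') : φ'.symm (trans φ φ' y) = φ.symm y :=
  φ'.left_inv hy.2

theorem trans_mem_overlap (hy : y ∈ overlap φ φ') : trans φ φ' y ∈ overlap φ' φ := by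
  refine ⟨trans_mem_target hy, ?_⟩
  rw [Set.mem_preimage, symm_trans hy]
  exact φ.map_target hy.1

theorem trans_trans (hy : y ∈ overlap φ φ') : trans φ' φ (trans φ φ' y) = y := by
  rw [trans, symm_trans hy, φ.right_inv hy.1]

variable [IsManifold (𝓡 n) ∞ X]

theorem mem_maximalAtlas (hφ : φ ∈ atlas (Model n) X) : φ ∈ IsManifold.maximalAtlas (𝓡 n) ∞ X :=
  IsManifold.subset_maximalAtlas hφ

theorem contDiffOn_trans (hφ : φ ∈ atlas (Model n) X) (hφ' : φ' ∈ atlas (Model n) X) :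
    ContDiffOn ℝ ∞ (trans φ φ') (overlap φ φ') := by
  rw [← contMDiffOn_iff_contDiffOn]
  exact (contMDiffOn_of_mem_maximalAtlas (mem_maximalAtlas hφ')).comp
    ((contMDiffOn_symm_of_mem_maximalAtlas (mem_maximalAtlas hφ)).mono Set.inter_subset_left)
    fun z hz => hz.2

theorem contDiffOn_trans_apply (hφ : φ ∈ atlas (Model n) X) (hφ' : φ' ∈ atlas (Model n) X)
    (k : Fin n) : ContDiffOn ℝ ∞ (fun z => trans φ φ' z k) (overlap φ φ') :=
  (EuclideanSpace.proj k : Model n →L[ℝ] ℝ).contDiff.comp_contDiffOn (contDiffOn_trans hφ hφ')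

theorem differentiableAt_trans (hφ : φ ∈ atlas (Model n) X) (hφ' : φ' ∈ atlas (Model n) X)
    (hy : y ∈ overlap φ φ') : DifferentiableAt ℝ (trans φ φ') y :=
  ((contDiffOn_trans hφ hφ' y hy).contDiffAt
    ((isOpen_overlap φ φ').mem_nhds hy)).differentiableAt (by simp)

theorem contDiffOn_jac (hφ : φ ∈ atlas (Model n) X) (hφ' : φ' ∈ atlas (Model n) X)
    (k i : Fin n) : ContDiffOn ℝ ∞ (fun z => jac φ φ' z k i) (overlap φ φ') :=
  contDiffOn_pderiv (isOpen_overlap φ φ') (contDiffOn_trans_apply hφ hφ' k) i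

theorem jac_eq_fderiv (hφ : φ ∈ atlas (Model n) X) (hφ' : φ' ∈ atlas (Model n) X)
    (hy : y ∈ overlap φ φ') (k i : Fin n) :
    jac φ φ' y k i = fderiv ℝ (trans φ φ') y (EuclideanSpace.single i 1) k := by
  have h := (EuclideanSpace.proj k : Model n →L[ℝ] ℝ).hasFDerivAt.comp y
    (differentiableAt_trans hφ hφ' hy).hasFDerivAt
  change fderiv ℝ (⇑(EuclideanSpace.proj k : Model n →L[ℝ] ℝ) ∘ trans φ φ') y _ = _
  rw [h.fderiv]
  rfl

/-- The chain rule applied to the composite of the two coordinate changes, which is the identity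
near `y`. -/
theorem jac_mul_jac (hφ : φ ∈ atlas (Model n) X) (hφ' : φ' ∈ atlas (Model n) X)
    (hy : y ∈ overlap φ φ') : jac φ' φ (trans φ φ' y) * jac φ φ' y = 1 := by
  ext k i
  have hd := differentiableAt_of_contDiffOn (isOpen_overlap φ' φ)
    (contDiffOn_trans_apply hφ' hφ k) (trans_mem_overlap hy)
  have h1 := pderiv_comp i hd (differentiableAt_trans hφ hφ' hy)
  have h2 : pderiv i (fun z => trans φ' φ (trans φ φ' z) k) y = pderiv i (fun z => z k) y := by
    refine pderiv_congr i ?_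
    filter_upwards [(isOpen_overlap φ φ').mem_nhds hy] with z hz
    rw [trans_trans hz]
  have h3 : pderiv i (fun z : Model n => z k) y = (1 : Matrix (Fin n) (Fin n) ℝ) k i := by
    have : HasFDerivAt (fun z : Model n => z k) (EuclideanSpace.proj k : Model n →L[ℝ] ℝ) y :=
      (EuclideanSpace.proj k : Model n →L[ℝ] ℝ).hasFDerivAt
    rw [pderiv, this.fderiv]
    simp [Matrix.one_apply]
  rw [← h3, ← h2, h1, Matrix.mul_apply]
  simp only [jac, Matrix.of_apply]
  exact Finset.sum_congr rfl fun _ _ => mul_comm _ _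

theorem sum_single_smul (v : Model n) :
    v = ∑ k, v k • (EuclideanSpace.single k 1 : Model n) := by
  ext j
  simp [Finset.sum_apply, Pi.single_apply]

theorem mdifferentiableAt_symm (hφ : φ ∈ atlas (Model n) X) (hy : y ∈ φ.target) :
    MDifferentiableAt (𝓡 n) (𝓡 n) φ.symm y :=
  ((contMDiffOn_symm_of_mem_maximalAtlas (mem_maximalAtlas hφ)).contMDiffAt
    (φ.open_target.mem_nhds hy)).mdifferentiableAt (by simp)

theorem mdifferentiableAt_chart (hφ : φ ∈ atlas (Model n) X) {x : X} (hx : x ∈ φ.source) :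
    MDifferentiableAt (𝓡 n) (𝓡 n) φ x :=
  ((contMDiffOn_of_mem_maximalAtlas (mem_maximalAtlas hφ)).contMDiffAt
    (φ.open_source.mem_nhds hx)).mdifferentiableAt (by simp)

theorem comp_apply_eq_sum {A B C : Model n →L[ℝ] Model n} (h : A = B.comp C) (v : Model n) :
    A v = ∑ k, (C v) k • B (EuclideanSpace.single k 1) := by
  rw [h, ContinuousLinearMap.comp_apply]
  conv_lhs => rw [sum_single_smul (C v), map_sum]
  simp only [map_smul]

theorem proj_comp_eq_sum {A B C : Model n →L[ℝ] Model n} (h : A = C.comp B) (i : Fin n) :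
    (EuclideanSpace.proj i : Model n →L[ℝ] ℝ).comp A
      = ∑ k, (C (EuclideanSpace.single k 1)) i •
          (EuclideanSpace.proj k : Model n →L[ℝ] ℝ).comp B := by
  ext v
  have hv : (A v) i = ∑ k, (B v) k * (C (EuclideanSpace.single k 1)) i := by
    rw [comp_apply_eq_sum h v]
    simp
  change (A v) i = _
  rw [hv, sum_apply]
  exact Finset.sum_congr rfl fun k _ => mul_comm _ _

/-- Coordinate vectors, as elements of the model space. -/
theorem coordVec_trans (hφ : φ ∈ atlas (Model n) X) (hφ' : φ' ∈ atlas (Model n) X)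
    (hy : y ∈ overlap φ φ') (i : Fin n) :
    (coordVec φ i y : Model n)
      = ∑ k, jac φ φ' y k i • (coordVec φ' k (trans φ φ' y) : Model n) := by
  have hd := differentiableAt_trans hφ hφ' hy
  -- Every tangent space is definitionally the model space; ascribing that type avoids transport
  -- between the equal base points `φ.symm y` and `φ'.symm (trans φ φ' y)`.
  have h1 : (mfderiv (𝓡 n) (𝓡 n) φ.symm y : Model n →L[ℝ] Model n)
      = (mfderiv (𝓡 n) (𝓡 n) φ'.symm (trans φ φ' y) : Model n →L[ℝ] Model n).comp
        (fderiv ℝ (trans φ φ') y) := by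
    have h2 : φ.symm =ᶠ[𝓝 y] φ'.symm ∘ trans φ φ' := by
      filter_upwards [(isOpen_overlap φ φ').mem_nhds hy] with z hz
      exact (symm_trans hz).symm
    have h3 : HasMFDerivAt (𝓡 n) (𝓡 n) (φ'.symm ∘ trans φ φ') y
        ((mfderiv (𝓡 n) (𝓡 n) φ'.symm (trans φ φ' y) : Model n →L[ℝ] Model n).comp
        (fderiv ℝ (trans φ φ') y)) :=
      HasMFDerivAt.comp y (mdifferentiableAt_symm hφ' (trans_mem_target hy)).hasMFDerivAt
        hd.hasFDerivAt.hasMFDerivAt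
    exact (h3.congr_of_eventuallyEq h2).mfderiv
  simp only [jac_eq_fderiv hφ hφ' hy]
  exact comp_apply_eq_sum h1 _

/-- Near the base point `φ` is `trans φ' φ` after `φ'`, so covectors transform by the Jacobian of
the inverse coordinate change. -/
theorem coordCovec_trans (hφ : φ ∈ atlas (Model n) X) (hφ' : φ' ∈ atlas (Model n) X)
    (hy : y ∈ overlap φ φ') (i : Fin n) :
    (coordCovec φ i y : Model n →L[ℝ] ℝ)
      = ∑ k, jac φ' φ (trans φ φ' y) i k •
        (coordCovec φ' k (trans φ φ' y) : Model n →L[ℝ] ℝ) := by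
  have hy' := trans_mem_overlap hy
  have hd := differentiableAt_trans hφ' hφ hy'
  have h1 : (mfderiv (𝓡 n) (𝓡 n) φ (φ.symm y) : Model n →L[ℝ] Model n)
      = (fderiv ℝ (trans φ' φ) (trans φ φ' y)).comp
        (mfderiv (𝓡 n) (𝓡 n) φ' (φ.symm y) : Model n →L[ℝ] Model n) := by
    have h2 : φ =ᶠ[𝓝 (φ.symm y)] trans φ' φ ∘ φ' := by
      filter_upwards [φ'.open_source.mem_nhds hy.2] with z hz
      simp only [Function.comp_apply, trans]
      rw [φ'.left_inv hz]
    have h3 : HasMFDerivAt (𝓡 n) (𝓡 n) (trans φ' φ ∘ φ') (φ.symm y)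
        ((fderiv ℝ (trans φ' φ) (trans φ φ' y)).comp
        (mfderiv (𝓡 n) (𝓡 n) φ' (φ.symm y) : Model n →L[ℝ] Model n)) :=
      HasMFDerivAt.comp (φ.symm y) hd.hasFDerivAt.hasMFDerivAt
        (mdifferentiableAt_chart hφ' hy.2).hasMFDerivAt
    exact (h3.congr_of_eventuallyEq h2).mfderiv
  have h4 : (coordCovec φ' · (trans φ φ' y) : Fin n → Model n →L[ℝ] ℝ)
      = fun k => (EuclideanSpace.proj k : Model n →L[ℝ] ℝ).comp
        (mfderiv (𝓡 n) (𝓡 n) φ' (φ.symm y) : Model n →L[ℝ] Model n) := by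
    funext k
    have := symm_trans hy
    change (EuclideanSpace.proj k : Model n →L[ℝ] ℝ).comp
      (mfderiv (𝓡 n) (𝓡 n) φ' (φ'.symm (trans φ φ' y)) : Model n →L[ℝ] Model n) = _
    rw [this]
  have h5 : ∀ k, (coordCovec φ' k (trans φ φ' y) : Model n →L[ℝ] ℝ) = _ := fun k => congrFun h4 k
  simp only [jac_eq_fderiv hφ' hφ hy']
  refine (proj_comp_eq_sum h1 i).trans (Finset.sum_congr rfl fun k _ => ?_)
  exact congrArg _ (h5 k).symm

end Charts

/-! ### Arrays with upper and lower indices as vectors -/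

/-- A component field as a field of vectors indexed by all the slots at once. -/
def vec {n r s : ℕ} (T : CompField n r s) (y : Model n) : (Fin r ⊕ Fin s → Fin n) → ℝ :=
  fun L => T y (L ∘ Sum.inl) (L ∘ Sum.inr)

/-- The family with matrix `A` in the upper slots and `B` in the lower slots. -/
def slots {n : ℕ} (r s : ℕ) (A B : Matrix (Fin n) (Fin n) ℝ) :
    Fin r ⊕ Fin s → Matrix (Fin n) (Fin n) ℝ :=
  Sum.elim (fun _ => A) (fun _ => B)

section Slots

variable {n r s : ℕ}

theorem vec_elim (T : CompField n r s) (y : Model n) (I : Fin r → Fin n) (J : Fin s → Fin n) :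
    vec T y (Sum.elim I J) = T y I J := rfl

theorem vec_ext {T T' : (Fin r ⊕ Fin s → Fin n) → ℝ}
    (h : ∀ I J, T (Sum.elim I J) = T' (Sum.elim I J)) : T = T' := by
  funext L
  rw [← Sum.elim_comp_inl_inr L]
  exact h _ _

theorem sum_slots (F : (Fin r ⊕ Fin s → Fin n) → ℝ) :
    ∑ L, F L = ∑ I : Fin r → Fin n, ∑ J : Fin s → Fin n, F (Sum.elim I J) := by
  rw [← Fintype.sum_prod_type' (f := fun I J => F (Sum.elim I J))]
  exact Fintype.sum_equiv (Equiv.sumArrowEquivProdArrow _ _ _) _ _ fun L => by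
    simp [Equiv.sumArrowEquivProdArrow]

theorem kron_slots (A B : Matrix (Fin n) (Fin n) ℝ) (I I' : Fin r → Fin n)
    (J J' : Fin s → Fin n) :
    kron (slots r s A B) (Sum.elim I J) (Sum.elim I' J')
      = (∏ a, A (I a) (I' a)) * ∏ b, B (J b) (J' b) := by
  simp [kron_apply, slots]

theorem slots_mul (A B A' B' : Matrix (Fin n) (Fin n) ℝ) :
    kron (slots r s (A * A') (B * B')) = kron (slots r s A B) * kron (slots r s A' B') := by
  rw [← kron_mul]
  congr 1
  funext a
  cases a <;> rfl

theorem slots_transpose (A B : Matrix (Fin n) (Fin n) ℝ) :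
    kron (slots r s A.transpose B.transpose) = (kron (slots r s A B)).transpose := by
  rw [← kron_transpose]
  congr 1
  funext a
  cases a <;> rfl

/-- As a quadratic form of a Kronecker matrix, the norm inherits symmetry, positivity, invariance
and the Leibniz rule from statements about single slots. -/
theorem compNormSq_eq {X : Type*} [TopologicalSpace X] [ChartedSpace (Model n) X]
    [IsManifold (𝓡 n) ∞ X] (φ : OpenPartialHomeomorph X (Model n)) (g : Metric n X)
    (T : CompField n r s) (y : Model n) :
    compNormSq φ g T y
      = vec T y ⬝ᵥ (kron (slots r s (gram φ g y) (gramInv φ g y))).mulVec (vec T y) := by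
  simp only [compNormSq, dotProduct, Matrix.mulVec, sum_slots, kron_slots, vec_elim]
  refine Finset.sum_congr rfl fun I _ => ?_
  rw [Finset.sum_comm]
  refine Finset.sum_congr rfl fun J _ => ?_
  rw [Finset.mul_sum]
  refine Finset.sum_congr rfl fun I' _ => ?_
  rw [Finset.mul_sum]
  exact Finset.sum_congr rfl fun J' _ => by ring

/-- Stated for fixed modules, so that the point-dependent tangent spaces do not interfere when it is
applied to tensor components. -/
theorem multilinear_expand {V W : Type*} [AddCommGroup V] [Module ℝ V] [AddCommGroup W]
    [Module ℝ W] (M : MultilinearMap ℝ (fun _ : Fin r => V)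
      (MultilinearMap ℝ (fun _ : Fin s => W) ℝ))
    (A B : Matrix (Fin n) (Fin n) ℝ) (c : Fin n → V) (v : Fin n → W) (I : Fin r → Fin n)
    (J : Fin s → Fin n) :
    M (fun a => ∑ k, A (I a) k • c k) (fun b => ∑ k, B (J b) k • v k)
      = (kron (slots r s A B)).mulVec
          (fun L => M (fun a => c (L (Sum.inl a))) (fun b => v (L (Sum.inr b))))
          (Sum.elim I J) := by
  simp only [Matrix.mulVec, dotProduct, sum_slots, kron_slots, Sum.elim_inl, Sum.elim_inr]
  rw [M.map_sum fun a k => A (I a) k • c k, sum_apply]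
  refine Finset.sum_congr rfl fun I' _ => ?_
  rw [M.map_smul_univ (fun a => A (I a) (I' a)), smul_apply, MultilinearMap.map_sum,
    Finset.smul_sum]
  refine Finset.sum_congr rfl fun J' _ => ?_
  rw [MultilinearMap.map_smul_univ _ (fun b => B (J b) (J' b))]
  simp only [smul_eq_mul]
  ring

theorem bilinear_expand {V : Type*} [NormedAddCommGroup V] [NormedSpace ℝ V]
    (F : V →L[ℝ] V →L[ℝ] ℝ) (A : Matrix (Fin n) (Fin n) ℝ) (v : Fin n → V) (i j : Fin n) :
    F (∑ k, A k i • v k) (∑ k, A k j • v k)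
      = (A.transpose * Matrix.of (fun k l => F (v k) (v l)) * A) i j := by
  simp only [Matrix.mul_apply, Matrix.of_apply, Matrix.transpose_apply, map_sum, sum_apply,
    map_smul, smul_apply, smul_eq_mul, Finset.sum_mul, Finset.mul_sum]
  exact Finset.sum_congr rfl fun k _ => Finset.sum_congr rfl fun l _ => by ring

theorem bilinear_expand_self {V : Type*} [NormedAddCommGroup V] [NormedSpace ℝ V]
    (F : V →L[ℝ] V →L[ℝ] ℝ) (c : Fin n → ℝ) (v : Fin n → V) :
    F (∑ k, c k • v k) (∑ k, c k • v k)
      = c ⬝ᵥ (Matrix.of fun k l => F (v k) (v l)).mulVec c := by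
  simp only [Matrix.mulVec, dotProduct, Matrix.of_apply, map_sum, sum_apply,
    map_smul, smul_apply, smul_eq_mul, Finset.mul_sum]
  rw [Finset.sum_comm]
  exact Finset.sum_congr rfl fun k _ => Finset.sum_congr rfl fun l _ => by ring

end Slots

/-! ### Tensor components and Gram matrices under changes of charts -/

section Metric

variable {n : ℕ} {X : Type*} [TopologicalSpace X] [ChartedSpace (Model n) X]
  [IsManifold (𝓡 n) ∞ X] {φ φ' : OpenPartialHomeomorph X (Model n)} {y : Model n}

theorem tensorComp_trans {r s : ℕ} (hφ : φ ∈ atlas (Model n) X) (hφ' : φ' ∈ atlas (Model n) X)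
    (T : ∀ x : X, TensorAt n r s x) (hy : y ∈ overlap φ φ') :
    vec (tensorComp φ T) y
      = (kron (slots r s (jac φ' φ (trans φ φ' y)) (jac φ φ' y).transpose)).mulVec
          (vec (tensorComp φ' T) (trans φ φ' y)) := by
  refine vec_ext fun I J => ?_
  let F : X → MultilinearMap ℝ (fun _ : Fin r => Model n →L[ℝ] ℝ)
      (MultilinearMap ℝ (fun _ : Fin s => Model n) ℝ) := fun x => T x
  have h1 : vec (tensorComp φ' T) (trans φ φ' y) = fun L =>
      F (φ.symm y) (fun a => (coordCovec φ' (L (Sum.inl a)) (trans φ φ' y) : Model n →L[ℝ] ℝ))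
        (fun b => (coordVec φ' (L (Sum.inr b)) (trans φ φ' y) : Model n)) := by
    rw [← symm_trans hy]
    rfl
  rw [h1]
  have hc : (fun a => (coordCovec φ (I a) y : Model n →L[ℝ] ℝ)) = _ :=
    funext fun a => coordCovec_trans hφ hφ' hy (I a)
  have hv : (fun b => (coordVec φ (J b) y : Model n)) = _ :=
    funext fun b => coordVec_trans hφ hφ' hy (J b)
  exact (congrArg₂ (fun c v => F (φ.symm y) c v) hc hv).trans
    (multilinear_expand (F (φ.symm y)) (jac φ' φ (trans φ φ' y)) (jac φ φ' y).transpose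
      (fun k => (coordCovec φ' k (trans φ φ' y) : Model n →L[ℝ] ℝ))
      (fun k => (coordVec φ' k (trans φ φ' y) : Model n)) I J)

theorem gram_trans (hφ : φ ∈ atlas (Model n) X) (hφ' : φ' ∈ atlas (Model n) X)
    (g : Metric n X) (hy : y ∈ overlap φ φ') :
    gram φ g y = (jac φ φ' y).transpose * gram φ' g (trans φ φ' y) * jac φ φ' y := by
  let F : X → Model n →L[ℝ] Model n →L[ℝ] ℝ := fun x => g.inner x
  have h1 : gram φ' g (trans φ φ' y) = Matrix.of fun k l =>
      F (φ.symm y) (coordVec φ' k (trans φ φ' y) : Model n)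
        (coordVec φ' l (trans φ φ' y) : Model n) := by
    rw [← symm_trans hy]
    rfl
  ext i j
  rw [h1]
  exact (congrArg₂ (fun v w => F (φ.symm y) v w) (coordVec_trans hφ hφ' hy i)
    (coordVec_trans hφ hφ' hy j)).trans (bilinear_expand (F (φ.symm y)) (jac φ φ' y)
      (fun k => (coordVec φ' k (trans φ φ' y) : Model n)) i j)

theorem gram_symm (φ : OpenPartialHomeomorph X (Model n)) (g : Metric n X) (y : Model n) :
    (gram φ g y).transpose = gram φ g y := by
  ext i j
  exact g.symm _ _ _

/-- The differential of `φ` is a left inverse of that of `φ.symm`, so a nonzero coefficient vector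
gives a nonzero tangent vector, on which `g` is positive. -/
theorem gram_posDef (hφ : φ ∈ atlas (Model n) X) (g : Metric n X) (hy : y ∈ φ.target) :
    (gram φ g y).PosDef := by
  refine Matrix.PosDef.of_dotProduct_mulVec_pos ?_ fun v hv => ?_
  · ext i j
    exact g.symm _ _ _
  · let A : Model n →L[ℝ] Model n := mfderiv (𝓡 n) (𝓡 n) φ.symm y
    let B : Model n →L[ℝ] Model n := mfderiv (𝓡 n) (𝓡 n) φ (φ.symm y)
    let F : Model n →L[ℝ] Model n →L[ℝ] ℝ := g.inner (φ.symm y)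
    have hBA : ∀ w, B (A w) = w := by
      have h3 : HasMFDerivAt (𝓡 n) (𝓡 n) (φ ∘ φ.symm) y (B.comp A) :=
        HasMFDerivAt.comp y (mdifferentiableAt_chart hφ (φ.map_target hy)).hasMFDerivAt
          (mdifferentiableAt_symm hφ hy).hasMFDerivAt
      have h4 : HasMFDerivAt (𝓡 n) (𝓡 n) (φ ∘ φ.symm) y (ContinuousLinearMap.id ℝ (Model n)) := by
        refine (hasMFDerivAt_id y).congr_of_eventuallyEq ?_
        filter_upwards [φ.open_target.mem_nhds hy] with z hz
        exact φ.right_inv hz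
      have h5 := hasMFDerivAt_unique h3 h4
      intro w
      exact congrArg (fun (f : Model n →L[ℝ] Model n) => f w) h5
    let w : Model n := ∑ i, v i • (EuclideanSpace.single i 1 : Model n)
    have hw : A w ≠ 0 := by
      intro h0
      have : w = 0 := by rw [← hBA w, h0, map_zero]
      refine hv (funext fun i => ?_)
      have h6 : w i = v i := by simp [w, Pi.single_apply]
      rw [← h6, this]
      rfl
    have hpos : 0 < F (A w) (A w) := g.pos (φ.symm y) (A w) hw
    have hA : A w = ∑ i, v i • A (EuclideanSpace.single i 1) := by
      simp only [w, map_sum, map_smul]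
    rw [hA, bilinear_expand_self] at hpos
    exact hpos

/-- The coordinate fields are smooth into the tangent bundle, being the tangent map of `φ.symm`
applied to a constant field; the smooth bundle metric is then evaluated on two of them. -/
theorem contDiffOn_gram (hφ : φ ∈ atlas (Model n) X) (g : Metric n X) (i j : Fin n) :
    ContDiffOn ℝ ∞ (fun y => gram φ g y i j) φ.target := by
  have hs := contMDiffOn_symm_of_mem_maximalAtlas (mem_maximalAtlas hφ)
  have hv : ∀ i, ContMDiffOn (𝓡 n) (𝓡 n).tangent ∞
      (fun y => (⟨φ.symm y, coordVec φ i y⟩ : TangentBundle (𝓡 n) X)) φ.target := by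
    intro i
    have h1 := hs.contMDiffOn_tangentMapWithin (m := ∞) (by simp) φ.open_target.uniqueMDiffOn
    have h2 : ContMDiffOn (𝓡 n) (𝓡 n).tangent ∞
        (fun y : Model n =>
          (⟨y, (EuclideanSpace.single i 1 : Model n)⟩ : TangentBundle (𝓡 n) (Model n)))
        φ.target :=
      contMDiffOn_vectorSpace_iff_contDiffOn.2 contDiffOn_const
    refine (h1.comp h2 fun z hz => hz).congr fun z hz => ?_
    simp only [Function.comp_apply, tangentMapWithin]
    rw [mfderivWithin_of_isOpen φ.open_target hz]
    rfl
  have hg := g.contMDiff.comp_contMDiffOn hs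
  have := ContMDiffOn.clm_bundle_apply₂ (F₁ := Model n) (F₂ := Model n) (F₃ := ℝ)
    (E₁ := fun x : X => TangentSpace (𝓡 n) x) (E₂ := fun x : X => TangentSpace (𝓡 n) x)
    (E₃ := Bundle.Trivial X ℝ) hg (hv i) (hv j)
  intro z hz
  have h2 := this z hz
  rw [Bundle.contMDiffWithinAt_totalSpace] at h2
  exact h2.2.contDiffWithinAt

end Metric

/-! ### The Levi-Civita connection in a chart -/

theorem contDiffOn_det {n : ℕ} {κ : Type*} [Fintype κ] [DecidableEq κ]
    {A : Model n → Matrix κ κ ℝ} {O : Set (Model n)}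
    (hA : ∀ i j, ContDiffOn ℝ ∞ (fun z => A z i j) O) : ContDiffOn ℝ ∞ (fun z => (A z).det) O := by
  simp only [Matrix.det_apply]
  refine ContDiffOn.sum fun σ _ => ContDiffOn.const_smul _ ?_
  exact contDiffOn_prod fun i _ => hA _ _

/-- Cramer's rule: adjugate entries are determinants, hence polynomial in the entries. -/
theorem contDiffOn_inv {n : ℕ} {κ : Type*} [Fintype κ] [DecidableEq κ]
    {A : Model n → Matrix κ κ ℝ} {O : Set (Model n)}
    (hA : ∀ i j, ContDiffOn ℝ ∞ (fun z => A z i j) O) (h0 : ∀ z ∈ O, (A z).det ≠ 0) (i j : κ) :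
    ContDiffOn ℝ ∞ (fun z => (A z)⁻¹ i j) O := by
  simp only [Matrix.inv_def, Matrix.smul_apply, Ring.inverse_eq_inv', smul_eq_mul,
    Matrix.adjugate_apply]
  refine ((contDiffOn_det hA).inv h0).mul (contDiffOn_det fun k l => ?_)
  by_cases h : k = j
  · subst h
    simp only [Matrix.updateRow_self]
    exact contDiffOn_const
  · simp only [Matrix.updateRow_ne h]
    exact hA k l

section

variable {n : ℕ} {X : Type*} [TopologicalSpace X] [ChartedSpace (Model n) X]
  [IsManifold (𝓡 n) ∞ X] {φ φ' : OpenPartialHomeomorph X (Model n)} {y : Model n}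
  {g : Metric n X}

theorem det_gram_ne_zero (hφ : φ ∈ atlas (Model n) X) (g : Metric n X) (hy : y ∈ φ.target) :
    (gram φ g y).det ≠ 0 :=
  ((Matrix.isUnit_iff_isUnit_det _).1 (gram_posDef hφ g hy).isUnit).ne_zero

theorem gramInv_mul_gram (hφ : φ ∈ atlas (Model n) X) (g : Metric n X) (hy : y ∈ φ.target) :
    gramInv φ g y * gram φ g y = 1 :=
  Matrix.nonsing_inv_mul _ (det_gram_ne_zero hφ g hy).isUnit

theorem gram_mul_gramInv (hφ : φ ∈ atlas (Model n) X) (g : Metric n X) (hy : y ∈ φ.target) :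
    gram φ g y * gramInv φ g y = 1 :=
  Matrix.mul_nonsing_inv _ (det_gram_ne_zero hφ g hy).isUnit

theorem contDiffOn_gramInv (hφ : φ ∈ atlas (Model n) X) (g : Metric n X) (i j : Fin n) :
    ContDiffOn ℝ ∞ (fun y => gramInv φ g y i j) φ.target :=
  contDiffOn_inv (contDiffOn_gram hφ g) (fun _ hz => det_gram_ne_zero hφ g hz) i j

theorem contDiffOn_christoffel (hφ : φ ∈ atlas (Model n) X) (g : Metric n X) (k i j : Fin n) :
    ContDiffOn ℝ ∞ (fun y => christoffel φ g k i j y) φ.target := by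
  unfold christoffel
  have hd : ∀ a b c, ContDiffOn ℝ ∞ (fun y => pderiv a (fun z => gram φ g z b c) y) φ.target :=
    fun a b c => contDiffOn_pderiv φ.open_target (contDiffOn_gram hφ g b c) a
  exact contDiffOn_const.mul (ContDiffOn.sum fun l _ => (contDiffOn_gramInv hφ g k l).mul
    (((hd _ _ _).add (hd _ _ _)).sub (hd _ _ _)))

/-- The matrix `(Γᵏₘⱼ)ₖⱼ` of Christoffel symbols. -/
def connMatrix (φ : OpenPartialHomeomorph X (Model n)) (g : Metric n X) (m : Fin n)
    (y : Model n) : Matrix (Fin n) (Fin n) ℝ :=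
  Matrix.of fun k j => christoffel φ g k m j y

theorem gram_comm (φ : OpenPartialHomeomorph X (Model n)) (g : Metric n X) (y : Model n)
    (i j : Fin n) : gram φ g y i j = gram φ g y j i :=
  congrFun (congrFun (gram_symm φ g y) j) i

theorem christoffel_comm (φ : OpenPartialHomeomorph X (Model n)) (g : Metric n X) (k i j : Fin n)
    (y : Model n) : christoffel φ g k i j y = christoffel φ g k j i y := by
  simp only [christoffel]
  congr 1
  refine Finset.sum_congr rfl fun l _ => ?_
  have : (fun z => gram φ g z i j) = fun z => gram φ g z j i :=
    funext fun z => gram_comm φ g z i j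
  rw [this]
  ring

/-- Lowering the upper index cancels the inverse metric and leaves the Christoffel symbols of the
first kind. -/
theorem gram_mul_connMatrix (hφ : φ ∈ atlas (Model n) X) (g : Metric n X) (hy : y ∈ φ.target)
    (m l j : Fin n) :
    (gram φ g y * connMatrix φ g m y) l j = (1 / 2 : ℝ) *
      (pderiv m (fun z => gram φ g z j l) y + pderiv j (fun z => gram φ g z m l) y
        - pderiv l (fun z => gram φ g z m j) y) := by
  let D : Matrix (Fin n) (Fin n) ℝ := Matrix.of fun l j => (1 / 2 : ℝ) *
      (pderiv m (fun z => gram φ g z j l) y + pderiv j (fun z => gram φ g z m l) y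
        - pderiv l (fun z => gram φ g z m j) y)
  have h : connMatrix φ g m y = gramInv φ g y * D := by
    ext k j
    simp only [connMatrix, christoffel, Matrix.of_apply, Matrix.mul_apply, D, Finset.mul_sum]
    exact Finset.sum_congr rfl fun _ _ => by ring
  rw [h, ← mul_assoc, gram_mul_gramInv hφ g hy, one_mul]
  rfl

/-- The Levi-Civita connection is compatible with the metric. -/
theorem mderiv_gram (hφ : φ ∈ atlas (Model n) X) (g : Metric n X) (hy : y ∈ φ.target)
    (m : Fin n) :
    mderiv m (gram φ g) y
      = (connMatrix φ g m y).transpose * gram φ g y + gram φ g y * connMatrix φ g m y := by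
  have h1 : (connMatrix φ g m y).transpose * gram φ g y
      = (gram φ g y * connMatrix φ g m y).transpose := by
    rw [Matrix.transpose_mul, gram_symm]
  ext i j
  have h2 : ∀ a b, (fun z => gram φ g z a b) = fun z => gram φ g z b a :=
    fun a b => funext fun z => gram_comm φ g z a b
  rw [h1, Matrix.add_apply, Matrix.transpose_apply, gram_mul_connMatrix hφ g hy,
    gram_mul_connMatrix hφ g hy, mderiv, Matrix.of_apply, h2 j i]
  ring

/-- The Levi-Civita connection is the only symmetric connection compatible with the metric. -/
theorem connMatrix_unique (hφ : φ ∈ atlas (Model n) X) (g : Metric n X) (hy : y ∈ φ.target)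
    (Γ : Fin n → Matrix (Fin n) (Fin n) ℝ) (hsymm : ∀ i j k, Γ i k j = Γ j k i)
    (hcompat : ∀ m, mderiv m (gram φ g) y
      = (Γ m).transpose * gram φ g y + gram φ g y * Γ m) (m : Fin n) :
    connMatrix φ g m y = Γ m := by
  suffices h : gram φ g y * connMatrix φ g m y = gram φ g y * Γ m by
    have := congrArg (gramInv φ g y * ·) h
    simpa only [← mul_assoc, gramInv_mul_gram hφ g hy, one_mul] using this
  have h1 : ∀ a b c, pderiv a (fun z => gram φ g z b c) y
      = (gram φ g y * Γ a) b c + (gram φ g y * Γ a) c b := by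
    intro a b c
    have := congrFun (congrFun (hcompat a) b) c
    rw [show (Γ a).transpose * gram φ g y = (gram φ g y * Γ a).transpose by
      rw [Matrix.transpose_mul, gram_symm]] at this
    rw [Matrix.add_apply, Matrix.transpose_apply] at this
    rw [add_comm, ← this]
    rfl
  have h2 : ∀ a b c, (gram φ g y * Γ a) b c = (gram φ g y * Γ c) b a := by
    intro a b c
    simp only [Matrix.mul_apply]
    exact Finset.sum_congr rfl fun k _ => by rw [hsymm a c k]
  ext l j
  -- Koszul's computation: `h1` is compatibility and `h2` is symmetry with the index lowered; in the
  -- alternating sum of three derivatives all but two equal terms cancel.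
  rw [gram_mul_connMatrix hφ g hy, h1, h1, h1, h2 j l m, h2 j m l, h2 l j m]
  ring

theorem differentiableAt_gram (hφ : φ ∈ atlas (Model n) X) (g : Metric n X) (hy : y ∈ φ.target)
    (i j : Fin n) : DifferentiableAt ℝ (fun z => gram φ g z i j) y :=
  differentiableAt_of_contDiffOn φ.open_target (contDiffOn_gram hφ g i j) hy

theorem differentiableAt_gramInv (hφ : φ ∈ atlas (Model n) X) (g : Metric n X)
    (hy : y ∈ φ.target) (i j : Fin n) : DifferentiableAt ℝ (fun z => gramInv φ g z i j) y :=
  differentiableAt_of_contDiffOn φ.open_target (contDiffOn_gramInv hφ g i j) hy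

theorem differentiableAt_jac (hφ : φ ∈ atlas (Model n) X) (hφ' : φ' ∈ atlas (Model n) X)
    (hy : y ∈ overlap φ φ') (i j : Fin n) : DifferentiableAt ℝ (fun z => jac φ φ' z i j) y :=
  differentiableAt_of_contDiffOn (isOpen_overlap φ φ') (contDiffOn_jac hφ hφ' i j) hy

theorem mderiv_congr {α β : Type*} (m : Fin n) {A B : Model n → Matrix α β ℝ}
    (h : A =ᶠ[𝓝 y] B) : mderiv m A y = mderiv m B y := by
  ext a b
  exact pderiv_congr m (h.mono fun z hz => congrFun (congrFun hz a) b)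

theorem mderiv_const {α β : Type*} (m : Fin n) (A : Matrix α β ℝ) :
    mderiv m (fun _ => A) y = 0 := by
  ext a b
  exact pderiv_const m _

theorem mderiv_transpose {α β : Type*} (m : Fin n) (A : Model n → Matrix α β ℝ) :
    mderiv m (fun z => (A z).transpose) y = (mderiv m A y).transpose := rfl

theorem mderiv_comp {α β : Type*} (hφ : φ ∈ atlas (Model n) X) (hφ' : φ' ∈ atlas (Model n) X)
    (hy : y ∈ overlap φ φ') (m : Fin n) {A : Model n → Matrix α β ℝ}
    (hA : ∀ a b, DifferentiableAt ℝ (fun z => A z a b) (trans φ φ' y)) :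
    mderiv m (fun z => A (trans φ φ' z)) y
      = ∑ k, jac φ φ' y k m • mderiv k A (trans φ φ' y) := by
  ext a b
  simp only [mderiv, Matrix.of_apply, Matrix.sum_apply, Matrix.smul_apply, smul_eq_mul]
  exact pderiv_comp m (hA a b) (differentiableAt_trans hφ hφ' hy)

theorem differentiableAt_comp_trans (hφ : φ ∈ atlas (Model n) X) (hφ' : φ' ∈ atlas (Model n) X)
    (hy : y ∈ overlap φ φ') {f : Model n → ℝ} (hf : DifferentiableAt ℝ f (trans φ φ' y)) :
    DifferentiableAt ℝ (fun z => f (trans φ φ' z)) y :=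
  hf.comp y (differentiableAt_trans hφ hφ' hy)

/-- The pull-back of the connection matrices under a change of charts. -/
def pullConn (φ φ' : OpenPartialHomeomorph X (Model n)) (g : Metric n X) (m : Fin n)
    (y : Model n) : Matrix (Fin n) (Fin n) ℝ :=
  ∑ k, jac φ φ' y k m • connMatrix φ' g k (trans φ φ' y)

theorem mderiv_gram_trans (hφ : φ ∈ atlas (Model n) X) (hφ' : φ' ∈ atlas (Model n) X)
    (g : Metric n X) (hy : y ∈ overlap φ φ') (m : Fin n) :
    mderiv m (fun z => gram φ' g (trans φ φ' z)) y
      = (pullConn φ φ' g m y).transpose * gram φ' g (trans φ φ' y)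
        + gram φ' g (trans φ φ' y) * pullConn φ φ' g m y := by
  have hy' := trans_mem_target hy
  rw [mderiv_comp hφ hφ' hy m (differentiableAt_gram hφ' g hy')]
  simp only [mderiv_gram hφ' g hy', pullConn, Matrix.transpose_sum, Matrix.transpose_smul,
    Finset.sum_mul, Finset.mul_sum, Matrix.smul_mul, Matrix.mul_smul, smul_add,
    Finset.sum_add_distrib]

/-- The transformation law of the Christoffel symbols. -/
theorem jac_mul_connMatrix (hφ : φ ∈ atlas (Model n) X) (hφ' : φ' ∈ atlas (Model n) X)
    (g : Metric n X) (hy : y ∈ overlap φ φ') (m : Fin n) :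
    jac φ φ' y * connMatrix φ g m y
      = mderiv m (jac φ φ') y + pullConn φ φ' g m y * jac φ φ' y := by
  have hQP := jac_mul_jac hφ hφ' hy
  have hPQ := mul_eq_one_comm.1 hQP
  set P := jac φ φ' y with hP
  set Q := jac φ' φ (trans φ φ' y)
  let R : Fin n → Matrix (Fin n) (Fin n) ℝ := fun m =>
    mderiv m (jac φ φ') y + pullConn φ φ' g m y * P
  have hPQR : ∀ m, P * (Q * R m) = R m := fun m => by rw [← mul_assoc, hPQ, one_mul]
  have hRsymm : ∀ i j k, R i k j = R j k i := by
    intro i j k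
    simp only [R, Matrix.add_apply]
    congr 1
    · exact pderiv_comm (isOpen_overlap φ φ') (contDiffOn_trans_apply hφ hφ' k) hy i j
    · simp only [pullConn, Matrix.mul_apply, Matrix.sum_apply, Matrix.smul_apply, smul_eq_mul,
        Finset.sum_mul, connMatrix, Matrix.of_apply]
      rw [Finset.sum_comm]
      refine Finset.sum_congr rfl fun a _ => Finset.sum_congr rfl fun b _ => ?_
      rw [christoffel_comm]
      ring
  -- Instead of transforming the defining formula, the candidate `Q * R m` is shown to be symmetric
  -- and compatible with `g`; uniqueness then identifies it.
  have key : connMatrix φ g m y = Q * R m := by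
    refine connMatrix_unique hφ g hy.1 (fun m => Q * R m) ?_ ?_ m
    · intro i j k
      simp only [Matrix.mul_apply]
      exact Finset.sum_congr rfl fun l _ => by rw [hRsymm i j l]
    · intro m
      have h1 : gram φ g =ᶠ[𝓝 y] fun z =>
          (jac φ φ' z).transpose * gram φ' g (trans φ φ' z) * jac φ φ' z := by
        filter_upwards [(isOpen_overlap φ φ').mem_nhds hy] with z hz
        exact gram_trans hφ hφ' g hz
      have hdJ := differentiableAt_jac hφ hφ' hy
      have hdG : ∀ a b, DifferentiableAt ℝ (fun z => gram φ' g (trans φ φ' z) a b) y :=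
        fun a b => differentiableAt_comp_trans hφ hφ' hy
          (differentiableAt_gram hφ' g (trans_mem_target hy) a b)
      have hdJt : ∀ a b, DifferentiableAt ℝ (fun z => (jac φ φ' z).transpose a b) y :=
        fun a b => hdJ b a
      have hdJG : ∀ a b, DifferentiableAt ℝ
          (fun z => ((jac φ φ' z).transpose * gram φ' g (trans φ φ' z)) a b) y := by
        intro a b
        simp only [Matrix.mul_apply]
        exact DifferentiableAt.fun_sum fun c _ => (hdJ c a).fun_mul (hdG c b)
      rw [mderiv_congr m h1, mderiv_mul m hdJG hdJ, mderiv_mul m hdJt hdG,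
        mderiv_transpose, mderiv_gram_trans hφ hφ' g hy, gram_trans hφ hφ' g hy]
      have h2 : (jac φ φ' y).transpose * gram φ' g (trans φ φ' y) * jac φ φ' y * (Q * R m)
          = P.transpose * gram φ' g (trans φ φ' y) * R m := by
        rw [← hP, mul_assoc _ P, hPQR]
      have h3 : (Q * R m).transpose * ((jac φ φ' y).transpose * gram φ' g (trans φ φ' y)
          * jac φ φ' y) = (R m).transpose * gram φ' g (trans φ φ' y) * P := by
        rw [← hP, ← mul_assoc, ← mul_assoc, ← Matrix.transpose_mul, hPQR]
      rw [h2, h3]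
      simp only [R, ← hP, Matrix.transpose_add, Matrix.transpose_mul, add_mul, mul_add, mul_assoc]
      abel
  rw [key, hPQR]

/-- The transformation law in the form needed for upper indices. Differentiating `Q P = 1` gives `∂Q
= -Q (∂P) Q`, and `jac_mul_connMatrix` removes `∂P`. -/
theorem mderiv_jac_trans (hφ : φ ∈ atlas (Model n) X) (hφ' : φ' ∈ atlas (Model n) X)
    (g : Metric n X) (hy : y ∈ overlap φ φ') (m : Fin n) :
    mderiv m (fun z => jac φ' φ (trans φ φ' z)) y
        + connMatrix φ g m y * jac φ' φ (trans φ φ' y)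
      = jac φ' φ (trans φ φ' y) * pullConn φ φ' g m y := by
  have hQP := jac_mul_jac hφ hφ' hy
  have hPQ := mul_eq_one_comm.1 hQP
  have h1 : (fun z => jac φ' φ (trans φ φ' z) * jac φ φ' z) =ᶠ[𝓝 y] fun _ => 1 := by
    filter_upwards [(isOpen_overlap φ φ').mem_nhds hy] with z hz
    exact jac_mul_jac hφ hφ' hz
  have h2 := mderiv_congr m h1
  rw [mderiv_const, mderiv_mul m (fun a b => differentiableAt_comp_trans hφ hφ' hy
    (differentiableAt_jac hφ' hφ (trans_mem_overlap hy) a b))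
    (differentiableAt_jac hφ hφ' hy)] at h2
  have h3 := jac_mul_connMatrix hφ hφ' g hy m
  set P := jac φ φ' y
  set Q := jac φ' φ (trans φ φ' y)
  set D := mderiv m (fun z => jac φ' φ (trans φ φ' z)) y
  have h4 : D = -(Q * mderiv m (jac φ φ') y * Q) := by
    have := congrArg (· * Q) h2
    simp only [add_mul, zero_mul, mul_assoc D, hPQ, mul_one] at this
    exact eq_neg_of_add_eq_zero_left this
  have h5 : connMatrix φ g m y = Q * (mderiv m (jac φ φ') y + pullConn φ φ' g m y * P) := by
    rw [← h3, ← mul_assoc, hQP, one_mul]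
  rw [h4, h5]
  simp only [mul_add, add_mul, mul_assoc, hPQ, mul_one]
  abel

end

/-! ### Tensoriality of the covariant derivative -/

/-- The component field obtained by fixing the first lower index. -/
def slice {n r s : ℕ} (m : Fin n) (T : CompField n r (s + 1)) : CompField n r s :=
  fun y I J => T y I (Fin.cons m J)

/-- Smoothness of all the components on a set. -/
def SmoothComp {n r s : ℕ} (T : CompField n r s) (O : Set (Model n)) : Prop :=
  ∀ I J, ContDiffOn ℝ ∞ (fun y => T y I J) O

theorem SmoothComp.differentiableAt_vec {n r s : ℕ} {T : CompField n r s} {O : Set (Model n)}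
    (hT : SmoothComp T O) (hO : IsOpen O) {y : Model n} (hy : y ∈ O)
    (L : Fin r ⊕ Fin s → Fin n) : DifferentiableAt ℝ (fun z => vec T z L) y :=
  differentiableAt_of_contDiffOn hO (hT _ _) hy

theorem SmoothComp.slice {n r s : ℕ} {T : CompField n r (s + 1)} {O : Set (Model n)}
    (hT : SmoothComp T O) (m : Fin n) : SmoothComp (slice m T) O :=
  fun I J => hT I (Fin.cons m J)

/-- Splits off the first lower slot, the one that holds the direction of differentiation. -/
theorem kron_slots_succ_mulVec {n r s : ℕ} (A B : Matrix (Fin n) (Fin n) ℝ)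
    (T : CompField n r (s + 1)) (y : Model n) (m : Fin n) (I : Fin r → Fin n)
    (J : Fin s → Fin n) :
    (kron (slots r (s + 1) A B)).mulVec (vec T y) (Sum.elim I (Fin.cons m J))
      = ∑ k, B m k * (kron (slots r s A B)).mulVec (vec (slice k T) y) (Sum.elim I J) := by
  simp only [Matrix.mulVec, dotProduct, sum_slots, kron_slots, vec_elim, Finset.mul_sum]
  rw [Finset.sum_comm]
  simp_rw [← (Fin.consEquiv fun _ : Fin (s + 1) => Fin n).sum_comp, Fintype.sum_prod_type]
  rw [Finset.sum_comm]
  rw [Finset.sum_comm (s := Finset.univ (α := Fin s → Fin n))]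
  refine Finset.sum_congr rfl fun k _ => ?_
  rw [Finset.sum_comm]
  refine Finset.sum_congr rfl fun I' _ => Finset.sum_congr rfl fun J' _ => ?_
  have hc : (Fin.consEquiv fun _ : Fin (s + 1) => Fin n) (k, J') = Fin.cons k J' := rfl
  simp only [hc, Fin.prod_univ_succ, Fin.cons_zero, Fin.cons_succ, slice]
  ring

theorem vec_ext_slice {n r s : ℕ} {v w : (Fin r ⊕ Fin (s + 1) → Fin n) → ℝ}
    (h : ∀ m I J, v (Sum.elim I (Fin.cons m J)) = w (Sum.elim I (Fin.cons m J))) : v = w := by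
  refine vec_ext fun I J => ?_
  rw [← Fin.cons_self_tail J]
  exact h _ _ _

section

variable {n : ℕ} {X : Type*} [TopologicalSpace X] [ChartedSpace (Model n) X]
  [IsManifold (𝓡 n) ∞ X] {φ φ' : OpenPartialHomeomorph X (Model n)} {y : Model n}
  {g : Metric n X} {r s : ℕ}

/-- The connection matrices acting on upper and lower indices. -/
def connSlots (r s : ℕ) (φ : OpenPartialHomeomorph X (Model n)) (g : Metric n X) (m : Fin n)
    (y : Model n) : Fin r ⊕ Fin s → Matrix (Fin n) (Fin n) ℝ :=
  slots r s (connMatrix φ g m y) (-(connMatrix φ g m y).transpose)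

/-- The Christoffel sums change one index at a time, which is how `kronDeriv` at the identity acts.
In a fixed direction `∇` thus becomes `∂` plus a matrix. -/
theorem vec_slice_covDeriv (φ : OpenPartialHomeomorph X (Model n)) (g : Metric n X)
    (T : CompField n r s) (m : Fin n) (y : Model n) :
    vec (slice m (covDeriv φ g T)) y
      = vderiv m (vec T) y
        + (kronDeriv (fun _ => 1) (connSlots r s φ g m y)).mulVec (vec T y) := by
  refine vec_ext fun I J => ?_
  rw [Pi.add_apply, kronDeriv_one_mulVec, Fintype.sum_sum_type]
  simp only [vec_elim, slice, covDeriv, Fin.cons_zero, Fin.tail_cons, connSlots, slots,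
    Sum.elim_inl, Sum.elim_inr, Sum.update_elim_inl, Sum.update_elim_inr, Matrix.neg_apply,
    Matrix.transpose_apply, connMatrix, Matrix.of_apply, neg_mul, Finset.sum_neg_distrib]
  rw [add_sub_assoc, sub_eq_add_neg]
  rfl

theorem contDiffOn_vec {T : CompField n r s} {O : Set (Model n)} (hT : SmoothComp T O)
    (L : Fin r ⊕ Fin s → Fin n) : ContDiffOn ℝ ∞ (fun z => vec T z L) O := hT _ _

theorem SmoothComp.covDeriv {T : CompField n r s} (hφ : φ ∈ atlas (Model n) X)
    (g : Metric n X) (hT : SmoothComp T φ.target) : SmoothComp (covDeriv φ g T) φ.target := by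
  intro I J
  unfold BIC.covDeriv
  have hΓ := contDiffOn_christoffel hφ g
  exact ((contDiffOn_pderiv φ.open_target (hT I (Fin.tail J)) (J 0)).add
    (ContDiffOn.sum fun a _ => ContDiffOn.sum fun l _ => (hΓ _ _ _).mul (hT _ _))).sub
    (ContDiffOn.sum fun a _ => ContDiffOn.sum fun l _ => (hΓ _ _ _).mul (hT _ _))

theorem SmoothComp.iterCovDeriv {T : CompField n r s} (hφ : φ ∈ atlas (Model n) X)
    (g : Metric n X) (hT : SmoothComp T φ.target) :
    ∀ k, SmoothComp (iterCovDeriv φ g T k) φ.target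
  | 0 => hT
  | k + 1 => (SmoothComp.iterCovDeriv hφ g hT k).covDeriv hφ g

/-- The matrix by which components transform under a change of charts. -/
def transMatrix (r s : ℕ) (φ φ' : OpenPartialHomeomorph X (Model n)) (y : Model n) :
    Matrix (Fin r ⊕ Fin s → Fin n) (Fin r ⊕ Fin s → Fin n) ℝ :=
  kron (slots r s (jac φ' φ (trans φ φ' y)) (jac φ φ' y).transpose)

/-- The components `T` and `T'` in the charts `φ` and `φ'` define the same tensor field. -/
def Related (φ φ' : OpenPartialHomeomorph X (Model n)) (T T' : CompField n r s) : Prop :=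
  ∀ y ∈ overlap φ φ', vec T y = (transMatrix r s φ φ' y).mulVec (vec T' (trans φ φ' y))

theorem differentiableAt_slots {A B : Model n → Matrix (Fin n) (Fin n) ℝ}
    (hA : ∀ i j, DifferentiableAt ℝ (fun z => A z i j) y)
    (hB : ∀ i j, DifferentiableAt ℝ (fun z => B z i j) y) (a : Fin r ⊕ Fin s) (i j : Fin n) :
    DifferentiableAt ℝ (fun z => slots r s (A z) (B z) a i j) y := by
  cases a
  · exact hA i j
  · exact hB i j

theorem vderiv_congr {α : Type*} (m : Fin n) {v w : Model n → α → ℝ} (h : v =ᶠ[𝓝 y] w) :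
    vderiv m v y = vderiv m w y :=
  funext fun a => pderiv_congr m (h.mono fun _ hz => congrFun hz a)

theorem vec_slice_covDeriv_trans (hφ : φ ∈ atlas (Model n) X) (hφ' : φ' ∈ atlas (Model n) X)
    (g : Metric n X) {T T' : CompField n r s} (hT' : SmoothComp T' φ'.target)
    (h : Related φ φ' T T') (hy : y ∈ overlap φ φ') (m : Fin n) :
    vec (slice m (covDeriv φ g T)) y
      = ∑ k, jac φ φ' y k m • (transMatrix r s φ φ' y).mulVec
          (vec (slice k (covDeriv φ' g T')) (trans φ φ' y)) := by
  have hy' := trans_mem_target hy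
  have h1 : vec T =ᶠ[𝓝 y] fun z => (transMatrix r s φ φ' z).mulVec (vec T' (trans φ φ' z)) := by
    filter_upwards [(isOpen_overlap φ φ').mem_nhds hy] with z hz
    exact h z hz
  have hdS := differentiableAt_slots (r := r) (s := s) (y := y)
    (A := fun z => jac φ' φ (trans φ φ' z)) (B := fun z => (jac φ φ' z).transpose)
    (fun a b => differentiableAt_comp_trans hφ hφ' hy
      (differentiableAt_jac hφ' hφ (trans_mem_overlap hy) a b))
    (fun a b => differentiableAt_jac hφ hφ' hy b a)
  have hdK : ∀ I J, DifferentiableAt ℝ (fun z => transMatrix r s φ φ' z I J) y :=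
    fun I J => differentiableAt_kron hdS I J
  have hdT : ∀ L, DifferentiableAt ℝ (fun z => vec T' (trans φ φ' z) L) y := fun L =>
    differentiableAt_comp_trans hφ hφ' hy (hT'.differentiableAt_vec φ'.open_target hy' L)
  have h2 : vderiv m (fun z => vec T' (trans φ φ' z)) y
      = ∑ k, jac φ φ' y k m • vderiv k (vec T') (trans φ φ' y) := by
    funext L
    simp only [vderiv, Finset.sum_apply, Pi.smul_apply, smul_eq_mul]
    exact pderiv_comp m (hT'.differentiableAt_vec φ'.open_target hy' L)
      (differentiableAt_trans hφ hφ' hy)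
  -- The gauge transformation law of the induced connection. It is checked slot by slot:
  -- `mderiv_jac_trans` for upper indices, the transpose of `jac_mul_connMatrix` for lower ones.
  have h3 : mderiv m (transMatrix r s φ φ') y
      + kronDeriv (fun _ => 1) (connSlots r s φ g m y) * transMatrix r s φ φ' y
      = transMatrix r s φ φ' y * ∑ k, jac φ φ' y k m •
          kronDeriv (fun _ => 1) (connSlots r s φ' g k (trans φ φ' y)) := by
    rw [← kronDeriv_sum]
    unfold transMatrix
    rw [mderiv_kron m (S := fun a z => slots r s (jac φ' φ (trans φ φ' z))
      (jac φ φ' z).transpose a) hdS, kronDeriv_mul_kron, kron_mul_kronDeriv]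
    simp only [one_mul, mul_one]
    rw [← kronDeriv_add]
    congr 1
    funext a
    cases a with
    | inl a => exact mderiv_jac_trans hφ hφ' g hy m
    | inr a =>
      have h4 := congrArg Matrix.transpose (jac_mul_connMatrix hφ hφ' g hy m)
      simp only [Matrix.transpose_mul, Matrix.transpose_add] at h4
      have h5 : mderiv m (fun z => (jac φ φ' z).transpose) y = (mderiv m (jac φ φ') y).transpose :=
        rfl
      have h6 : (∑ k, jac φ φ' y k m • -(connMatrix φ' g k (trans φ φ' y)).transpose)
          = -(pullConn φ φ' g m y).transpose := by
        simp [pullConn, Matrix.transpose_sum]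
      simp only [slots, connSlots, Sum.elim_inr]
      rw [h5, h6, neg_mul, h4, mul_neg]
      abel
  rw [vec_slice_covDeriv, vderiv_congr m h1, vderiv_mulVec m
    hdK hdT, h y hy, h2, Matrix.mulVec_mulVec,
    add_right_comm, ← Matrix.add_mulVec, h3]
  simp only [vec_slice_covDeriv, Matrix.mulVec_add, smul_add, Finset.sum_add_distrib,
    ← Matrix.mulVec_mulVec, Matrix.mulVec_sum, Matrix.sum_mulVec, Matrix.smul_mulVec,
    Matrix.mulVec_smul]
  abel

/-- The covariant derivatives of a tensor field in two charts agree. -/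
theorem Related.covDeriv (hφ : φ ∈ atlas (Model n) X) (hφ' : φ' ∈ atlas (Model n) X)
    (g : Metric n X) {T T' : CompField n r s} (hT' : SmoothComp T' φ'.target)
    (h : Related φ φ' T T') : Related φ φ' (covDeriv φ g T) (covDeriv φ' g T') := by
  intro y hy
  refine vec_ext_slice fun m I J => ?_
  unfold transMatrix
  rw [kron_slots_succ_mulVec]
  have := congrFun (vec_slice_covDeriv_trans hφ hφ' g hT' h hy m) (Sum.elim I J)
  simp only [Finset.sum_apply, Pi.smul_apply, smul_eq_mul] at this
  exact this

theorem Related.iterCovDeriv (hφ : φ ∈ atlas (Model n) X) (hφ' : φ' ∈ atlas (Model n) X)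
    (g : Metric n X) {T T' : CompField n r s} (hT' : SmoothComp T' φ'.target)
    (h : Related φ φ' T T') :
    ∀ k, Related φ φ' (iterCovDeriv φ g T k) (iterCovDeriv φ' g T' k)
  | 0 => h
  | k + 1 => (Related.iterCovDeriv hφ hφ' g hT' h k).covDeriv hφ hφ' g (hT'.iterCovDeriv hφ' g k)

theorem gramInv_trans (hφ : φ ∈ atlas (Model n) X) (hφ' : φ' ∈ atlas (Model n) X)
    (g : Metric n X) (hy : y ∈ overlap φ φ') :
    jac φ φ' y * gramInv φ g y * (jac φ φ' y).transpose = gramInv φ' g (trans φ φ' y) := by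
  have hQP := jac_mul_jac hφ hφ' hy
  have hPQ := mul_eq_one_comm.1 hQP
  refine (Matrix.inv_eq_left_inv ?_).symm
  have h1 := gram_trans hφ hφ' g hy
  have h2 : (jac φ φ' y).transpose * gram φ' g (trans φ φ' y)
      = gram φ g y * jac φ' φ (trans φ φ' y) := by
    rw [h1, mul_assoc _ (jac φ φ' y), hPQ, mul_one]
  rw [mul_assoc, h2, mul_assoc, ← mul_assoc (gramInv φ g y), gramInv_mul_gram hφ g hy.1, one_mul,
    hPQ]

/-- The norm of a tensor field does not depend on the chart. -/
theorem Related.compNormSq (hφ : φ ∈ atlas (Model n) X) (hφ' : φ' ∈ atlas (Model n) X)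
    (g : Metric n X) {T T' : CompField n r s} (h : Related φ φ' T T') (hy : y ∈ overlap φ φ') :
    compNormSq φ g T y = compNormSq φ' g T' (trans φ φ' y) := by
  rw [compNormSq_eq, compNormSq_eq, h y hy, Matrix.mulVec_mulVec, Matrix.dotProduct_mulVec,
    Matrix.dotProduct_mulVec, ← Matrix.mulVec_transpose, ← Matrix.mulVec_transpose,
    Matrix.mulVec_mulVec]
  congr 2
  have hPQ := mul_eq_one_comm.1 (jac_mul_jac hφ hφ' hy)
  have h1 : (jac φ' φ (trans φ φ' y)).transpose * gram φ g y * jac φ' φ (trans φ φ' y)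
      = gram φ' g (trans φ φ' y) := by
    rw [gram_trans hφ hφ' g hy, ← mul_assoc, ← mul_assoc, ← Matrix.transpose_mul, hPQ,
      Matrix.transpose_one, one_mul, mul_assoc, hPQ, mul_one]
  have h2 : (transMatrix r s φ φ' y).transpose * kron (slots r s (gram φ g y) (gramInv φ g y))
      * transMatrix r s φ φ' y
      = kron (slots r s (gram φ' g (trans φ φ' y)) (gramInv φ' g (trans φ φ' y))) := by
    unfold transMatrix
    rw [← slots_transpose, ← slots_mul, ← slots_mul, h1, Matrix.transpose_transpose,
      gramInv_trans hφ hφ' g hy]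
  rw [← h2]
  simp only [Matrix.transpose_mul, Matrix.transpose_transpose, Matrix.mul_assoc]

theorem SmoothTensorField.related (η : SmoothTensorField n X r s) (hφ : φ ∈ atlas (Model n) X)
    (hφ' : φ' ∈ atlas (Model n) X) :
    Related φ φ' (tensorComp φ η.toFun) (tensorComp φ' η.toFun) :=
  fun _ hy => tensorComp_trans hφ hφ' η.toFun hy

/-- The pointwise norm of `∇ᵏη` may be computed in any chart. -/
theorem covDerivNorm_eq (hφ : φ ∈ atlas (Model n) X) (g : Metric n X)
    (η : SmoothTensorField n X r s) (k : ℕ) {x : X} (hx : x ∈ φ.source) :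
    covDerivNorm g η k x
      = √(compNormSq φ g (iterCovDeriv φ g (tensorComp φ η.toFun) k) (φ x)) := by
  have hψ := chart_mem_atlas (Model n) x
  set ψ := chartAt (Model n) x with hψ'
  have hxs : x ∈ ψ.source := mem_chart_source _ x
  have hy : ψ x ∈ overlap ψ φ := by
    refine ⟨ψ.map_source hxs, ?_⟩
    rw [Set.mem_preimage, ψ.left_inv hxs]
    exact hx
  have h := ((η.related hψ hφ).iterCovDeriv hψ hφ g
    (fun I J => η.smooth φ hφ I J) k).compNormSq hψ hφ g hy
  rw [covDerivNorm, ← hψ', h, trans, ψ.left_inv hxs]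

end

/-! ### The inner product of tensor fields -/

section

variable {n : ℕ} {X : Type*} [TopologicalSpace X] [ChartedSpace (Model n) X]
  [IsManifold (𝓡 n) ∞ X] {φ : OpenPartialHomeomorph X (Model n)} {y : Model n}
  {g : Metric n X} {r s : ℕ}

/-- The Gram matrix of the inner product of tensors. -/
def tensorGram (r s : ℕ) (φ : OpenPartialHomeomorph X (Model n)) (g : Metric n X) (y : Model n) :
    Matrix (Fin r ⊕ Fin s → Fin n) (Fin r ⊕ Fin s → Fin n) ℝ :=
  kron (slots r s (gram φ g y) (gramInv φ g y))

/-- The inner product of two tensor fields, in components. -/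
def tensorInner (φ : OpenPartialHomeomorph X (Model n)) (g : Metric n X)
    (T S : CompField n r s) (y : Model n) : ℝ :=
  vec T y ⬝ᵥ (tensorGram r s φ g y).mulVec (vec S y)

theorem compNormSq_eq_tensorInner (φ : OpenPartialHomeomorph X (Model n)) (g : Metric n X)
    (T : CompField n r s) (y : Model n) : compNormSq φ g T y = tensorInner φ g T T y :=
  compNormSq_eq φ g T y

theorem gramInv_symm (φ : OpenPartialHomeomorph X (Model n)) (g : Metric n X) (y : Model n) :
    (gramInv φ g y).transpose = gramInv φ g y := by
  rw [gramInv, Matrix.transpose_nonsing_inv, gram_symm]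

theorem gramInv_comm (φ : OpenPartialHomeomorph X (Model n)) (g : Metric n X) (y : Model n)
    (i j : Fin n) : gramInv φ g y i j = gramInv φ g y j i :=
  congrFun (congrFun (gramInv_symm φ g y) j) i

theorem tensorGram_symm (r s : ℕ) (φ : OpenPartialHomeomorph X (Model n)) (g : Metric n X)
    (y : Model n) : (tensorGram r s φ g y).transpose = tensorGram r s φ g y := by
  rw [tensorGram, ← slots_transpose, gram_symm, gramInv_symm]

theorem tensorInner_comm (φ : OpenPartialHomeomorph X (Model n)) (g : Metric n X)
    (T S : CompField n r s) (y : Model n) : tensorInner φ g T S y = tensorInner φ g S T y := by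
  rw [tensorInner, tensorInner, Matrix.dotProduct_mulVec, ← Matrix.mulVec_transpose,
    tensorGram_symm, dotProduct_comm]

/-- Supplies the orthonormal frames for the Cauchy-Schwarz inequality and the maximum principle. -/
theorem exists_transpose_mul_self {κ : Type*} [Fintype κ] [DecidableEq κ] {A : Matrix κ κ ℝ}
    (hA : A.PosSemidef) : ∃ C : Matrix κ κ ℝ, A = C.transpose * C := by
  open scoped MatrixOrder in
  obtain ⟨C, hC⟩ := CStarAlgebra.nonneg_iff_eq_star_mul_self.mp hA.nonneg
  exact ⟨C, by rw [hC, Matrix.star_eq_conjTranspose, Matrix.conjTranspose_eq_transpose_of_trivial]⟩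

theorem gramInv_posSemidef (hφ : φ ∈ atlas (Model n) X) (g : Metric n X) (hy : y ∈ φ.target) :
    (gramInv φ g y).PosSemidef :=
  (gram_posDef hφ g hy).inv.posSemidef

/-- In an orthonormal frame the inner product of tensors is the dot product. -/
theorem exists_tensorInner_eq (r s : ℕ) (hφ : φ ∈ atlas (Model n) X) (g : Metric n X)
    (hy : y ∈ φ.target) :
    ∃ C : Matrix (Fin r ⊕ Fin s → Fin n) (Fin r ⊕ Fin s → Fin n) ℝ, ∀ T S : CompField n r s,
      tensorInner φ g T S y = C.mulVec (vec T y) ⬝ᵥ C.mulVec (vec S y) := by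
  obtain ⟨A, hA⟩ := exists_transpose_mul_self (gram_posDef hφ g hy).posSemidef
  obtain ⟨B, hB⟩ := exists_transpose_mul_self (gramInv_posSemidef hφ g hy)
  refine ⟨kron (slots r s A B), fun T S => ?_⟩
  rw [tensorInner, tensorGram, hA, hB, slots_mul, slots_transpose, ← Matrix.mulVec_mulVec,
    Matrix.dotProduct_mulVec, Matrix.vecMul_transpose]

theorem compNormSq_nonneg (hφ : φ ∈ atlas (Model n) X) (g : Metric n X) (hy : y ∈ φ.target)
    (T : CompField n r s) : 0 ≤ compNormSq φ g T y := by
  obtain ⟨C, hC⟩ := exists_tensorInner_eq r s hφ g hy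
  rw [compNormSq_eq_tensorInner, hC]
  exact Finset.sum_nonneg fun i _ => mul_self_nonneg _

/-- In an orthonormal frame this is the Euclidean Cauchy-Schwarz inequality. -/
theorem abs_tensorInner_le (hφ : φ ∈ atlas (Model n) X) (g : Metric n X) (hy : y ∈ φ.target)
    (T S : CompField n r s) :
    |tensorInner φ g T S y| ≤ √(compNormSq φ g T y) * √(compNormSq φ g S y) := by
  obtain ⟨C, hC⟩ := exists_tensorInner_eq r s hφ g hy
  have h := Finset.sum_mul_sq_le_sq_mul_sq Finset.univ (C.mulVec (vec T y)) (C.mulVec (vec S y))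
  rw [← Real.sqrt_mul (compNormSq_nonneg hφ g hy T)]
  refine Real.abs_le_sqrt ?_
  simp only [compNormSq_eq_tensorInner, hC, dotProduct]
  simpa only [sq] using h

/-- Obtained by differentiating `g⁻¹ g = 1` and inserting `mderiv_gram`. -/
theorem mderiv_gramInv (hφ : φ ∈ atlas (Model n) X) (g : Metric n X) (hy : y ∈ φ.target)
    (m : Fin n) :
    mderiv m (gramInv φ g) y = -(connMatrix φ g m y * gramInv φ g y)
      - gramInv φ g y * (connMatrix φ g m y).transpose := by
  have h1 : (fun z => gramInv φ g z * gram φ g z) =ᶠ[𝓝 y] fun _ => 1 := by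
    filter_upwards [φ.open_target.mem_nhds hy] with z hz
    exact gramInv_mul_gram hφ g hz
  have h2 := mderiv_congr m h1
  rw [mderiv_const, mderiv_mul m (differentiableAt_gramInv hφ g hy) (differentiableAt_gram hφ g hy),
    mderiv_gram hφ g hy] at h2
  have h3 := congrArg (· * gramInv φ g y) h2
  simp only [add_mul, zero_mul, mul_assoc, gram_mul_gramInv hφ g hy, mul_one, mul_add] at h3
  rw [← mul_assoc (gramInv φ g y) (gram φ g y), gramInv_mul_gram hφ g hy, one_mul] at h3
  rw [eq_neg_of_add_eq_zero_left h3]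
  abel

/-- Metric compatibility on tensors, from `mderiv_gram` in each upper slot and `mderiv_gramInv` in
each lower slot. -/
theorem mderiv_tensorGram (r s : ℕ) (hφ : φ ∈ atlas (Model n) X) (g : Metric n X)
    (hy : y ∈ φ.target) (m : Fin n) :
    mderiv m (tensorGram r s φ g) y
      = (kronDeriv (fun _ => 1) (connSlots r s φ g m y)).transpose * tensorGram r s φ g y
        + tensorGram r s φ g y * kronDeriv (fun _ => 1) (connSlots r s φ g m y) := by
  unfold tensorGram
  rw [mderiv_kron m (S := fun a z => slots r s (gram φ g z) (gramInv φ g z) a)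
    (differentiableAt_slots (differentiableAt_gram hφ g hy) (differentiableAt_gramInv hφ g hy)),
    ← kronDeriv_one_transpose, kronDeriv_mul_kron, kron_mul_kronDeriv]
  simp only [one_mul, mul_one]
  rw [← kronDeriv_add]
  congr 1
  funext a
  cases a with
  | inl a => exact mderiv_gram hφ g hy m
  | inr a =>
    simp only [slots, connSlots, Sum.elim_inr, Matrix.transpose_neg, Matrix.transpose_transpose]
    rw [neg_mul, mul_neg, ← sub_eq_add_neg]
    exact mderiv_gramInv hφ g hy m

theorem differentiableAt_tensorGram (hφ : φ ∈ atlas (Model n) X) (g : Metric n X)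
    (hy : y ∈ φ.target) (I J : Fin r ⊕ Fin s → Fin n) :
    DifferentiableAt ℝ (fun z => tensorGram r s φ g z I J) y :=
  differentiableAt_kron (S := fun a z => slots r s (gram φ g z) (gramInv φ g z) a)
    (differentiableAt_slots (differentiableAt_gram hφ g hy) (differentiableAt_gramInv hφ g hy)) I J

/-- The Leibniz rule for the inner product of tensor fields. -/
theorem pderiv_tensorInner (hφ : φ ∈ atlas (Model n) X) (g : Metric n X) (hy : y ∈ φ.target)
    {T S : CompField n r s} (hT : SmoothComp T φ.target) (hS : SmoothComp S φ.target)
    (m : Fin n) :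
    pderiv m (tensorInner φ g T S) y = tensorInner φ g (slice m (covDeriv φ g T)) S y
      + tensorInner φ g T (slice m (covDeriv φ g S)) y := by
  have hdT := hT.differentiableAt_vec φ.open_target hy
  have hdS := hS.differentiableAt_vec φ.open_target hy
  have hdG := differentiableAt_tensorGram (r := r) (s := s) hφ g hy
  change pderiv m (fun z => vec T z ⬝ᵥ (tensorGram r s φ g z).mulVec (vec S z)) y = _
  rw [pderiv_dotProduct m hdT (differentiableAt_mulVec hdG hdS), vderiv_mulVec m hdG hdS,
    mderiv_tensorGram r s hφ g hy]
  simp only [tensorInner, vec_slice_covDeriv, Matrix.add_mulVec, Matrix.mulVec_add,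
    add_dotProduct, dotProduct_add, ← Matrix.mulVec_mulVec]
  rw [Matrix.dotProduct_mulVec (vec T y) (Matrix.transpose _), Matrix.vecMul_transpose]
  ring

theorem contDiffOn_tensorInner (hφ : φ ∈ atlas (Model n) X) (g : Metric n X)
    {T S : CompField n r s} (hT : SmoothComp T φ.target) (hS : SmoothComp S φ.target) :
    ContDiffOn ℝ ∞ (tensorInner φ g T S) φ.target := by
  unfold tensorInner
  simp only [dotProduct, Matrix.mulVec]
  refine ContDiffOn.sum fun L _ => (contDiffOn_vec hT L).mul
    (ContDiffOn.sum fun L' _ => ContDiffOn.mul ?_ (contDiffOn_vec hS L'))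
  simp only [tensorGram, kron_apply]
  refine contDiffOn_prod fun a _ => ?_
  cases a
  · exact contDiffOn_gram hφ g _ _
  · exact contDiffOn_gramInv hφ g _ _

theorem contDiffOn_compNormSq (hφ : φ ∈ atlas (Model n) X) (g : Metric n X)
    {T : CompField n r s} (hT : SmoothComp T φ.target) :
    ContDiffOn ℝ ∞ (compNormSq φ g T) φ.target :=
  (contDiffOn_tensorInner hφ g hT hT).congr fun z _ => compNormSq_eq_tensorInner φ g T z

theorem tensorInner_succ (φ : OpenPartialHomeomorph X (Model n)) (g : Metric n X)
    (T S : CompField n r (s + 1)) (y : Model n) :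
    tensorInner φ g T S y
      = ∑ i, ∑ j, gramInv φ g y i j * tensorInner φ g (slice i T) (slice j S) y := by
  unfold tensorInner tensorGram
  simp only [dotProduct, sum_slots]
  simp_rw [← (Fin.consEquiv fun _ : Fin (s + 1) => Fin n).sum_comp, Fintype.sum_prod_type]
  have hc : ∀ (k : Fin n) (J : Fin s → Fin n),
      (Fin.consEquiv fun _ : Fin (s + 1) => Fin n) (k, J) = Fin.cons k J := fun _ _ => rfl
  simp only [hc, kron_slots_succ_mulVec, Finset.mul_sum]
  rw [Finset.sum_comm]
  refine Finset.sum_congr rfl fun i _ => ?_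
  refine (Finset.sum_congr rfl fun I _ => Finset.sum_comm).trans (Finset.sum_comm.trans ?_)
  refine Finset.sum_congr rfl fun j _ => Finset.sum_congr rfl fun I _ =>
    Finset.sum_congr rfl fun J _ => ?_
  simp only [vec_elim, slice]
  ring

end

section

variable {n : ℕ} {X : Type*} [TopologicalSpace X] [ChartedSpace (Model n) X]
  [IsManifold (𝓡 n) ∞ X] {φ : OpenPartialHomeomorph X (Model n)} {y : Model n}
  {g : Metric n X} {r s : ℕ}

/-! ### The Laplacian of the squared norm of a tensor field -/

/-- Freezing the index `j` before differentiating omits the Christoffel term of its slot. This term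
becomes the correction in the covariant Hessian. -/
theorem covDeriv_cons_cons (φ : OpenPartialHomeomorph X (Model n)) (g : Metric n X)
    (D : CompField n r (s + 1)) (y : Model n) (I : Fin r → Fin n) (J : Fin s → Fin n)
    (i j : Fin n) :
    covDeriv φ g D y I (Fin.cons i (Fin.cons j J : Fin (s + 1) → Fin n))
      = covDeriv φ g (slice j D) y I (Fin.cons i J)
        - ∑ l, christoffel φ g l i j y * D y I (Fin.cons l J) := by
  simp only [covDeriv, Fin.cons_zero, Fin.tail_cons, Fin.sum_univ_succ (n := s), Fin.cons_succ,
    Fin.update_cons_zero, ← Fin.cons_update, slice]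
  ring

theorem vec_slice_slice_covDeriv (φ : OpenPartialHomeomorph X (Model n)) (g : Metric n X)
    (D : CompField n r (s + 1)) (y : Model n) (i j : Fin n) :
    vec (slice j (slice i (covDeriv φ g D))) y
      = vec (slice i (covDeriv φ g (slice j D))) y
        - ∑ l, christoffel φ g l i j y • vec (slice l D) y := by
  refine vec_ext fun I J => ?_
  simp only [Pi.sub_apply, Finset.sum_apply, Pi.smul_apply, smul_eq_mul, vec_elim]
  exact covDeriv_cons_cons φ g D y I J i j

theorem pderiv_compNormSq (hφ : φ ∈ atlas (Model n) X) (g : Metric n X) (hy : y ∈ φ.target)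
    {T : CompField n r s} (hT : SmoothComp T φ.target) (j : Fin n) :
    pderiv j (compNormSq φ g T) y = 2 * tensorInner φ g (slice j (covDeriv φ g T)) T y := by
  rw [show compNormSq φ g T = tensorInner φ g T T from
    funext fun z => compNormSq_eq_tensorInner φ g T z, pderiv_tensorInner hφ g hy hT hT,
    tensorInner_comm φ g T]
  ring

/-- Two applications of the Leibniz rule; the Christoffel term of the Hessian is exactly the one
separating `∇(∇ⱼT)` from `∇∇T`. -/
theorem hessian_compNormSq (hφ : φ ∈ atlas (Model n) X) (g : Metric n X) (hy : y ∈ φ.target)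
    {T : CompField n r s} (hT : SmoothComp T φ.target) (i j : Fin n) :
    pderiv i (pderiv j (compNormSq φ g T)) y
        - ∑ k, christoffel φ g k i j y * pderiv k (compNormSq φ g T) y
      = 2 * tensorInner φ g (slice j (slice i (covDeriv φ g (covDeriv φ g T)))) T y
        + 2 * tensorInner φ g (slice i (covDeriv φ g T)) (slice j (covDeriv φ g T)) y := by
  have hD := hT.covDeriv hφ g
  have h1 : pderiv j (compNormSq φ g T) =ᶠ[𝓝 y]
      fun z => 2 * tensorInner φ g (slice j (covDeriv φ g T)) T z := by
    filter_upwards [φ.open_target.mem_nhds hy] with z hz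
    exact pderiv_compNormSq hφ g hz hT j
  rw [pderiv_congr i h1, pderiv_const_mul i 2 (differentiableAt_of_contDiffOn φ.open_target
    (contDiffOn_tensorInner hφ g (hD.slice j) hT) hy), pderiv_tensorInner hφ g hy (hD.slice j) hT,
    tensorInner_comm φ g (slice i (covDeriv φ g T)) (slice j _)]
  have h2 : tensorInner φ g (slice j (slice i (covDeriv φ g (covDeriv φ g T)))) T y
      = tensorInner φ g (slice i (covDeriv φ g (slice j (covDeriv φ g T)))) T y
        - ∑ k, christoffel φ g k i j y * tensorInner φ g (slice k (covDeriv φ g T)) T y := by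
    simp only [tensorInner, vec_slice_slice_covDeriv, sub_dotProduct, sum_dotProduct,
      smul_dotProduct, smul_eq_mul]
  rw [h2]
  simp only [pderiv_compNormSq hφ g hy hT, mul_left_comm _ (2 : ℝ), ← Finset.mul_sum]
  ring

/-- The tensor product of the metric with a tensor field. -/
def metricTensor (φ : OpenPartialHomeomorph X (Model n)) (g : Metric n X)
    (T : CompField n r s) : CompField n r (s + 2) :=
  fun y I J => gram φ g y (J 0) (J 1) * T y I (Fin.tail (Fin.tail J))

/-- The tensor product of the differential of a function with a tensor field. -/
def gradTensor (f : Model n → ℝ) (T : CompField n r s) : CompField n r (s + 1) :=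
  fun y I J => pderiv (J 0) f y * T y I (Fin.tail J)

theorem vec_slice_slice_metricTensor (φ : OpenPartialHomeomorph X (Model n)) (g : Metric n X)
    (T : CompField n r s) (y : Model n) (i j : Fin n) :
    vec (slice j (slice i (metricTensor φ g T))) y = gram φ g y i j • vec T y := rfl

theorem vec_slice_gradTensor (f : Model n → ℝ) (T : CompField n r s) (y : Model n) (i : Fin n) :
    vec (slice i (gradTensor f T)) y = pderiv i f y • vec T y := rfl

/-- Pairing with `g ⊗ T` traces the first two lower slots. So `⟨tr ∇²T, T⟩` is an inner product with
the full `∇²T`, ready for Cauchy-Schwarz. -/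
theorem tensorInner_metricTensor (hφ : φ ∈ atlas (Model n) X) (g : Metric n X)
    (hy : y ∈ φ.target) (R : CompField n r (s + 2)) (T : CompField n r s) :
    tensorInner φ g R (metricTensor φ g T) y
      = ∑ i, ∑ j, gramInv φ g y i j * tensorInner φ g (slice j (slice i R)) T y := by
  have h1 : ∀ i j k l, tensorInner φ g (slice j (slice i R))
      (slice l (slice k (metricTensor φ g T))) y
      = gram φ g y k l * tensorInner φ g (slice j (slice i R)) T y := by
    intro i j k l
    simp only [tensorInner, vec_slice_slice_metricTensor, Matrix.mulVec_smul, dotProduct_smul,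
      smul_eq_mul]
  have h2 : ∀ i l, ∑ k, gramInv φ g y i k * gram φ g y k l
      = (1 : Matrix (Fin n) (Fin n) ℝ) i l := by
    intro i l
    rw [← gramInv_mul_gram hφ g hy, Matrix.mul_apply]
  simp only [tensorInner_succ, h1, Finset.mul_sum]
  refine Finset.sum_congr rfl fun i _ => ?_
  rw [Finset.sum_comm]
  refine Finset.sum_congr rfl fun j _ => ?_
  rw [Finset.sum_comm]
  have h3 : ∀ l, ∑ k, gramInv φ g y i k * (gramInv φ g y j l *
      (gram φ g y k l * tensorInner φ g (slice j (slice i R)) T y))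
      = (1 : Matrix (Fin n) (Fin n) ℝ) i l *
        (gramInv φ g y j l * tensorInner φ g (slice j (slice i R)) T y) := by
    intro l
    rw [← h2, Finset.sum_mul]
    exact Finset.sum_congr rfl fun k _ => by ring
  simp only [h3, Matrix.one_apply, ite_mul, one_mul, zero_mul, Finset.sum_ite_eq,
    Finset.mem_univ, if_true]
  rw [gramInv_comm]

/-- The factor is `|g|² = tr 1`; it is the source of `√n` in the Bochner inequality. -/
theorem compNormSq_metricTensor (hφ : φ ∈ atlas (Model n) X) (g : Metric n X)
    (hy : y ∈ φ.target) (T : CompField n r s) :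
    compNormSq φ g (metricTensor φ g T) y = n * compNormSq φ g T y := by
  rw [compNormSq_eq_tensorInner, tensorInner_metricTensor hφ g hy]
  have h1 : ∀ i j, tensorInner φ g (slice j (slice i (metricTensor φ g T))) T y
      = gram φ g y i j * compNormSq φ g T y := by
    intro i j
    simp only [compNormSq_eq_tensorInner, tensorInner, vec_slice_slice_metricTensor,
      smul_dotProduct, smul_eq_mul]
  have h2 : ∀ i, ∑ j, gramInv φ g y i j * gram φ g y i j = 1 := by
    intro i
    have := congrFun (congrFun (gramInv_mul_gram hφ g hy) i) i
    rw [Matrix.mul_apply, Matrix.one_apply_eq] at this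
    rw [← this]
    exact Finset.sum_congr rfl fun j _ => by rw [gram_comm φ g y i j]
  simp only [h1, ← mul_assoc, ← Finset.sum_mul, h2]
  simp

/-- The inner product of the gradients of two functions of the coordinates. -/
def gradInner (φ : OpenPartialHomeomorph X (Model n)) (g : Metric n X) (f h : Model n → ℝ)
    (y : Model n) : ℝ :=
  ∑ i, ∑ j, gramInv φ g y i j * pderiv i f y * pderiv j h y

theorem compNormSq_gradTensor (φ : OpenPartialHomeomorph X (Model n)) (g : Metric n X)
    (f : Model n → ℝ) (T : CompField n r s) (y : Model n) :
    compNormSq φ g (gradTensor f T) y = compGradNormSq φ g f y * compNormSq φ g T y := by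
  simp only [compNormSq_eq_tensorInner, tensorInner_succ, compGradNormSq, Finset.sum_mul]
  refine Finset.sum_congr rfl fun i _ => Finset.sum_congr rfl fun j _ => ?_
  simp only [tensorInner, vec_slice_gradTensor, smul_dotProduct, Matrix.mulVec_smul,
    dotProduct_smul, smul_eq_mul]
  ring

/-- The Bochner inequality for the squared norm of a tensor field. -/
theorem le_compLaplacian_compNormSq (hφ : φ ∈ atlas (Model n) X) (g : Metric n X)
    (hy : y ∈ φ.target) {T : CompField n r s} (hT : SmoothComp T φ.target) :
    2 * compNormSq φ g (covDeriv φ g T) y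
        - 2 * (√(compNormSq φ g (covDeriv φ g (covDeriv φ g T)) y) *
          (√n * √(compNormSq φ g T y)))
      ≤ compLaplacian φ g (compNormSq φ g T) y := by
  -- The exact identity `Δ|T|² = 2⟨tr ∇²T, T⟩ + 2|∇T|²`, the trace of the Hessian formula.
  have h1 : compLaplacian φ g (compNormSq φ g T) y
      = 2 * tensorInner φ g (covDeriv φ g (covDeriv φ g T)) (metricTensor φ g T) y
        + 2 * compNormSq φ g (covDeriv φ g T) y := by
    rw [compLaplacian, tensorInner_metricTensor hφ g hy, compNormSq_eq_tensorInner,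
      tensorInner_succ φ g (covDeriv φ g T)]
    simp only [hessian_compNormSq hφ g hy hT, mul_add, Finset.sum_add_distrib, Finset.mul_sum,
      mul_left_comm _ (2 : ℝ)]
  have h2 := abs_tensorInner_le hφ g hy (covDeriv φ g (covDeriv φ g T)) (metricTensor φ g T)
  rw [compNormSq_metricTensor hφ g hy, Real.sqrt_mul (Nat.cast_nonneg n)] at h2
  rw [h1]
  linarith [(abs_le.1 h2).1]

theorem abs_gradInner_compNormSq_le (hφ : φ ∈ atlas (Model n) X) (g : Metric n X)
    (hy : y ∈ φ.target) {T : CompField n r s} (hT : SmoothComp T φ.target) {f : Model n → ℝ} :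
    |gradInner φ g f (compNormSq φ g T) y| ≤ 2 * (√(compGradNormSq φ g f y) *
      √(compNormSq φ g T y) * √(compNormSq φ g (covDeriv φ g T) y)) := by
  have h1 : gradInner φ g f (compNormSq φ g T) y
      = 2 * tensorInner φ g (gradTensor f T) (covDeriv φ g T) y := by
    rw [gradInner, tensorInner_succ]
    simp only [Finset.mul_sum, pderiv_compNormSq hφ g hy hT]
    refine Finset.sum_congr rfl fun i _ => Finset.sum_congr rfl fun j _ => ?_
    rw [tensorInner_comm φ g (slice j _) T]
    simp only [tensorInner, vec_slice_gradTensor, smul_dotProduct, smul_eq_mul]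
    ring
  have h2 := abs_tensorInner_le hφ g hy (gradTensor f T) (covDeriv φ g T)
  rw [compNormSq_gradTensor, Real.sqrt_mul' _ (compNormSq_nonneg hφ g hy T)] at h2
  rw [h1, abs_mul, abs_two]
  linarith

/-! ### Calculus of the Laplacian in a chart -/

theorem compGradNormSq_eq_gradInner (φ : OpenPartialHomeomorph X (Model n)) (g : Metric n X)
    (f : Model n → ℝ) (y : Model n) : compGradNormSq φ g f y = gradInner φ g f f y := rfl

theorem gradInner_comm (φ : OpenPartialHomeomorph X (Model n)) (g : Metric n X)
    (f h : Model n → ℝ) (y : Model n) : gradInner φ g f h y = gradInner φ g h f y := by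
  unfold gradInner
  rw [Finset.sum_comm]
  refine Finset.sum_congr rfl fun i _ => Finset.sum_congr rfl fun j _ => ?_
  rw [gramInv_comm φ g y j i]
  ring

variable {f h : Model n → ℝ} {O : Set (Model n)}

theorem pderiv_pderiv_mul (hO : IsOpen O) (hy : y ∈ O) (hf : ContDiffOn ℝ ∞ f O)
    (hh : ContDiffOn ℝ ∞ h O) (i j : Fin n) :
    pderiv i (pderiv j fun z => f z * h z) y
      = f y * pderiv i (pderiv j h) y + h y * pderiv i (pderiv j f) y
        + (pderiv i f y * pderiv j h y + pderiv j f y * pderiv i h y) := by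
  have d : ∀ {F : Model n → ℝ}, ContDiffOn ℝ ∞ F O → ∀ {z}, z ∈ O → DifferentiableAt ℝ F z :=
    fun hF _ hz => differentiableAt_of_contDiffOn hO hF hz
  have hf' := contDiffOn_pderiv hO hf j
  have hh' := contDiffOn_pderiv hO hh j
  have h1 : (pderiv j fun z => f z * h z) =ᶠ[𝓝 y]
      fun z => pderiv j f z * h z + f z * pderiv j h z := by
    filter_upwards [hO.mem_nhds hy] with z hz
    exact pderiv_mul j (d hf hz) (d hh hz)
  rw [pderiv_congr i h1, pderiv_add i ((d hf' hy).fun_mul (d hh hy))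
    ((d hf hy).fun_mul (d hh' hy)), pderiv_mul i (d hf' hy) (d hh hy),
    pderiv_mul i (d hf hy) (d hh' hy)]
  ring

theorem compLaplacian_mul (φ : OpenPartialHomeomorph X (Model n)) (g : Metric n X)
    (hO : IsOpen O) (hy : y ∈ O) (hf : ContDiffOn ℝ ∞ f O) (hh : ContDiffOn ℝ ∞ h O) :
    compLaplacian φ g (fun z => f z * h z) y
      = f y * compLaplacian φ g h y + h y * compLaplacian φ g f y
        + 2 * gradInner φ g f h y := by
  have hdf := differentiableAt_of_contDiffOn hO hf hy
  have hdh := differentiableAt_of_contDiffOn hO hh hy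
  rw [two_mul]
  nth_rw 2 [gradInner_comm]
  simp only [compLaplacian, gradInner, Finset.mul_sum, ← Finset.sum_add_distrib]
  refine Finset.sum_congr rfl fun i _ => Finset.sum_congr rfl fun j _ => ?_
  have h1 : ∑ k, christoffel φ g k i j y * pderiv k (fun z => f z * h z) y
      = f y * ∑ k, christoffel φ g k i j y * pderiv k h y
        + h y * ∑ k, christoffel φ g k i j y * pderiv k f y := by
    simp only [Finset.mul_sum, ← Finset.sum_add_distrib, pderiv_mul _ hdf hdh]
    exact Finset.sum_congr rfl fun k _ => by ring
  rw [pderiv_pderiv_mul hO hy hf hh, h1]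
  ring

theorem compLaplacian_add_const_mul (φ : OpenPartialHomeomorph X (Model n)) (g : Metric n X)
    (hO : IsOpen O) (hy : y ∈ O) (hf : ContDiffOn ℝ ∞ f O) (hh : ContDiffOn ℝ ∞ h O) (c : ℝ) :
    compLaplacian φ g (fun z => f z + c * h z) y
      = compLaplacian φ g f y + c * compLaplacian φ g h y := by
  have d : ∀ {F : Model n → ℝ}, ContDiffOn ℝ ∞ F O → ∀ {z}, z ∈ O → DifferentiableAt ℝ F z :=
    fun hF _ hz => differentiableAt_of_contDiffOn hO hF hz
  have h1 : ∀ j, ∀ z ∈ O,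
      pderiv j (fun z => f z + c * h z) z = pderiv j f z + c * pderiv j h z := by
    intro j z hz
    rw [pderiv_add j (d hf hz) ((d hh hz).const_mul c), pderiv_const_mul j c (d hh hz)]
  have h2 : ∀ i j, pderiv i (pderiv j fun z => f z + c * h z) y
      = pderiv i (pderiv j f) y + c * pderiv i (pderiv j h) y := by
    intro i j
    have hf' := d (contDiffOn_pderiv hO hf j) hy
    have hh' := d (contDiffOn_pderiv hO hh j) hy
    have h3 : (pderiv j fun z => f z + c * h z) =ᶠ[𝓝 y]
        fun z => pderiv j f z + c * pderiv j h z := by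
      filter_upwards [hO.mem_nhds hy] with z hz
      exact h1 j z hz
    rw [pderiv_congr i h3, pderiv_add i hf' (hh'.const_mul c), pderiv_const_mul i c hh']
  simp only [compLaplacian, Finset.mul_sum, ← Finset.sum_add_distrib]
  refine Finset.sum_congr rfl fun i _ => Finset.sum_congr rfl fun j _ => ?_
  simp only [h2, h1 _ y hy, mul_add, Finset.sum_add_distrib, mul_left_comm _ c, ← Finset.mul_sum]
  ring

theorem gradInner_pow (φ : OpenPartialHomeomorph X (Model n)) (g : Metric n X)
    (hf : DifferentiableAt ℝ f y) (m : ℕ) :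
    gradInner φ g (fun z => f z ^ m) h y = m * f y ^ (m - 1) * gradInner φ g f h y := by
  simp only [gradInner, Finset.mul_sum, pderiv_pow _ m hf]
  exact Finset.sum_congr rfl fun i _ => Finset.sum_congr rfl fun j _ => by ring

theorem gradInner_add_const_mul (φ : OpenPartialHomeomorph X (Model n)) (g : Metric n X)
    {f₁ f₂ : Model n → ℝ} (h₁ : DifferentiableAt ℝ f₁ y) (h₂ : DifferentiableAt ℝ f₂ y) (c : ℝ) :
    gradInner φ g f (fun z => f₁ z + c * f₂ z) y
      = gradInner φ g f f₁ y + c * gradInner φ g f f₂ y := by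
  simp only [gradInner, Finset.mul_sum, ← Finset.sum_add_distrib]
  refine Finset.sum_congr rfl fun i _ => Finset.sum_congr rfl fun j _ => ?_
  rw [pderiv_add j h₁ (h₂.const_mul c), pderiv_const_mul j c h₂]
  ring

/-- Induction with the product rule; the exponent `m + 2` avoids truncated subtraction. -/
theorem compLaplacian_pow (φ : OpenPartialHomeomorph X (Model n)) (g : Metric n X)
    (hO : IsOpen O) (hy : y ∈ O) (hf : ContDiffOn ℝ ∞ f O) (m : ℕ) :
    compLaplacian φ g (fun z => f z ^ (m + 2)) y
      = (m + 2) * f y ^ (m + 1) * compLaplacian φ g f y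
        + (m + 2) * (m + 1) * f y ^ m * compGradNormSq φ g f y := by
  have hd := differentiableAt_of_contDiffOn hO hf hy
  induction m with
  | zero =>
    have h1 := compLaplacian_mul φ g hO hy hf hf
    rw [show (fun z => f z ^ (0 + 2)) = fun z => f z * f z from funext fun z => by ring, h1,
      compGradNormSq_eq_gradInner]
    simp
    ring
  | succ m ih =>
    have h1 := compLaplacian_mul φ g hO hy (hf.pow (m + 2)) hf
    rw [show (fun z => f z ^ (m + 1 + 2)) = fun z => f z ^ (m + 2) * f z from
      funext fun z => by ring, h1, ih, gradInner_pow φ g hd (m + 2), compGradNormSq_eq_gradInner]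
    push_cast
    ring

/-! ### The maximum principle -/

theorem fderiv_apply_eq_sum (F : Model n → ℝ) (z v : Model n) :
    fderiv ℝ F z v = ∑ i, v i * pderiv i F z := by
  conv_lhs => rw [sum_single_smul v, map_sum]
  simp only [map_smul, smul_eq_mul, pderiv]

/-- Restrict `f` to the line through `y` along `v`. A positive second derivative would make the
maximum also a local minimum, so the restriction would be locally constant, with second derivative
zero. -/
theorem hessian_nonpos_of_isLocalMax (hO : IsOpen O) (hy : y ∈ O) (hf : ContDiffOn ℝ ∞ f O)
    (hmax : IsLocalMax f y) (v : Model n) :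
    ∑ i, ∑ j, v i * v j * pderiv i (pderiv j f) y ≤ 0 := by
  let c : ℝ → Model n := fun t => y + t • v
  have hc : ∀ t, HasDerivAt c v t := fun t => by
    have h := ((hasDerivAt_id t).smul_const v).const_add y
    rw [one_smul] at h
    exact h
  have hc0 : c 0 = y := by simp [c]
  have hcO : ∀ᶠ t in 𝓝 (0 : ℝ), c t ∈ O :=
    (hc 0).continuousAt.eventually (by rw [hc0]; exact hO.mem_nhds hy)
  have hder : ∀ {F : Model n → ℝ}, ContDiffOn ℝ ∞ F O → ∀ {t}, c t ∈ O →
      HasDerivAt (fun t => F (c t)) (∑ i, v i * pderiv i F (c t)) t := by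
    intro F hF t ht
    rw [← fderiv_apply_eq_sum]
    exact (differentiableAt_of_contDiffOn hO hF ht).hasFDerivAt.comp_hasDerivAt t (hc t)
  have hd1 : deriv (fun t => f (c t)) =ᶠ[𝓝 0] fun t => ∑ j, v j * pderiv j f (c t) :=
    hcO.mono fun t ht => (hder hf ht).deriv
  have h0 : c 0 ∈ O := by rwa [hc0]
  have hd2 : deriv (deriv fun t => f (c t)) 0 = ∑ i, ∑ j, v i * v j * pderiv i (pderiv j f) y := by
    rw [hd1.deriv_eq]
    have h1 : HasDerivAt (fun t => ∑ j, v j * pderiv j f (c t))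
        (∑ j, v j * ∑ i, v i * pderiv i (pderiv j f) (c 0)) 0 :=
      HasDerivAt.fun_sum fun j _ => (hder (contDiffOn_pderiv hO hf j) h0).const_mul (v j)
    rw [h1.deriv, hc0, Finset.sum_comm]
    simp only [Finset.mul_sum]
    exact Finset.sum_congr rfl fun j _ => Finset.sum_congr rfl fun i _ => by ring
  rw [← hd2]
  by_contra hpos
  push Not at hpos
  have hmax' : IsLocalMax (fun t => f (c t)) 0 := by
    have : ∀ᶠ z in 𝓝 (c 0), f z ≤ f (c 0) := by rw [hc0]; exact hmax
    exact (hc 0).continuousAt.eventually this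
  have hmin := isLocalMin_of_deriv_deriv_pos hpos hmax'.deriv_eq_zero
    (hder hf h0).continuousAt
  have hconst : (fun t => f (c t)) =ᶠ[𝓝 0] fun _ => f (c 0) :=
    (hmax'.and hmin).mono fun t ht => le_antisymm ht.1 ht.2
  have h2 : deriv (fun t => f (c t)) =ᶠ[𝓝 0] fun _ => 0 := by
    filter_upwards [hconst.eventually_nhds] with t ht
    rw [Filter.EventuallyEq.deriv_eq ht, deriv_const]
  rw [h2.deriv_eq, deriv_const] at hpos
  exact lt_irrefl _ hpos

/-- The gradient vanishes, which removes the Christoffel terms. Factoring the inverse metric as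
`CᵀC` turns the rest into a sum of Hessians along the rows of `C`. -/
theorem compLaplacian_nonpos_of_isLocalMax (hφ : φ ∈ atlas (Model n) X) (g : Metric n X)
    (hy : y ∈ φ.target) (hO : IsOpen O) (hyO : y ∈ O) (hf : ContDiffOn ℝ ∞ f O)
    (hmax : IsLocalMax f y) :
    compLaplacian φ g f y ≤ 0 := by
  have h1 : ∀ k, pderiv k f y = 0 := fun k => by
    rw [pderiv, hmax.fderiv_eq_zero]
    rfl
  obtain ⟨C, hC⟩ := exists_transpose_mul_self (gramInv_posSemidef hφ g hy)
  have h2 : compLaplacian φ g f y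
      = ∑ k, ∑ i, ∑ j, C k i * C k j * pderiv i (pderiv j f) y := by
    simp only [compLaplacian, h1, mul_zero, Finset.sum_const_zero, sub_zero, hC, Matrix.mul_apply,
      Matrix.transpose_apply, Finset.sum_mul]
    rw [Finset.sum_comm' (t' := Finset.univ) (s' := fun _ => Finset.univ) (by simp)]
    rw [Finset.sum_comm]
    refine (Finset.sum_congr rfl fun i _ => Finset.sum_comm).trans ?_
    rw [Finset.sum_comm]
  rw [h2]
  refine Finset.sum_nonpos fun k _ => ?_
  exact hessian_nonpos_of_isLocalMax hO hyO hf hmax (WithLp.toLp 2 (C k))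

end

/-! ### Interpolation by the maximum principle -/

/-- The constant in the interpolation step from order `j` to order `j + 1`. -/
def stepConst (n j : ℕ) (b : ℝ) : ℝ :=
  2 * √n + (2 * j + 2) ^ 2 * b + 4 * (2 * j + 2) * √b

theorem stepConst_nonneg (n j : ℕ) {b : ℝ} (hb : 0 ≤ b) : 0 ≤ stepConst n j b := by
  unfold stepConst
  positivity

/-- All quantities are values at the maximum point: `vᵢ` is `|∇^{j+i}η|`, `Lᵢ` is `Δ|∇^{j+i}η|²`,
`gᵢ` is `⟨∇ρ, ∇|∇^{j+i}η|²⟩`, and `Lρ`, `Gρ` are `Δρ`, `|∇ρ|²`. The hypothesis `hmax` is `ΔF ≤ 0`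
expanded by the product rule. -/
theorem interpolation_arith {n j : ℕ} {ρ b M δ v₀ v₁ v₂ v₃ L₀ L₁ Lρ Gρ g₀ g₁ : ℝ}
    (hρ₀ : 0 ≤ ρ) (hρ₁ : ρ ≤ 1) (hM : 0 < M) (hδ : 0 < δ)
    (hv₀ : 0 ≤ v₀) (hv₁ : 0 ≤ v₁) (hv₂ : 0 ≤ v₂) (hv₃ : 0 ≤ v₃)
    (h₀ : v₀ ≤ M) (h₁ : v₁ ≤ M) (h₂ : v₂ ≤ M) (h₃ : v₃ ≤ M) (hδv : ρ ^ j * v₀ ≤ δ)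
    (hL₁ : 2 * v₂ ^ 2 - 2 * (v₃ * (√n * v₁)) ≤ L₁)
    (hL₀ : 2 * v₁ ^ 2 - 2 * (v₂ * (√n * v₀)) ≤ L₀)
    (hG : 0 ≤ Gρ) (hb : Gρ + |Lρ| ≤ b)
    (hg₁ : |g₁| ≤ 2 * (√Gρ * v₁ * v₂)) (hg₀ : |g₀| ≤ 2 * (√Gρ * v₀ * v₁))
    (hmax : ρ ^ (2 * j + 2) * (L₁ + M / δ * L₀) + (v₁ ^ 2 + M / δ * v₀ ^ 2) *
      (((2 * j : ℕ) + 2) * ρ ^ (2 * j + 1) * Lρ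
        + ((2 * j : ℕ) + 2) * ((2 * j : ℕ) + 1) * ρ ^ (2 * j) * Gρ)
      + 2 * (((2 * j + 2 : ℕ) : ℝ) * ρ ^ (2 * j + 1) * (g₁ + M / δ * g₀)) ≤ 0) :
    ρ ^ (2 * j + 2) * (v₁ ^ 2 + M / δ * v₀ ^ 2) ≤ (stepConst n j b + 1) * M * δ := by
  have hLρ : |Lρ| ≤ b := by linarith
  have hGb : Gρ ≤ b := by linarith [abs_nonneg Lρ]
  have hb0 : 0 ≤ b := hG.trans hGb
  have hsG : √Gρ ≤ √b := Real.sqrt_le_sqrt hGb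
  -- The weight satisfies `l * δ = M`, so an error `M * δ` multiplied by `l` is again of size `M ^
  -- 2`.
  set l := M / δ with hl
  have hl0 : 0 < l := div_pos hM hδ
  have hlδ : l * δ = M := div_mul_cancel₀ M hδ.ne'
  set q : ℝ := 2 * j + 2 with hq
  have hq0 : 2 ≤ q := by
    have : (0 : ℝ) ≤ j := Nat.cast_nonneg j
    linarith
  set W := ρ ^ (2 * j + 2) with hW
  set V := ρ ^ (2 * j) with hV
  set R := ρ ^ (2 * j + 1) with hR
  have hW0 : 0 ≤ W := pow_nonneg hρ₀ _
  have hV0 : 0 ≤ V := pow_nonneg hρ₀ _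
  have hR0 : 0 ≤ R := pow_nonneg hρ₀ _
  have hW1 : W ≤ 1 := pow_le_one₀ hρ₀ hρ₁
  have hV1 : V ≤ 1 := pow_le_one₀ hρ₀ hρ₁
  have hR1 : R ≤ 1 := pow_le_one₀ hρ₀ hρ₁
  have hRV : R ≤ V := pow_le_pow_of_le_one hρ₀ hρ₁ (by omega)
  have hWV : W ≤ V := pow_le_pow_of_le_one hρ₀ hρ₁ (by omega)
  -- All three powers of `ρ` have exponent at least `j`, so each can absorb a factor `v₀` into `δ`.
  have hWv : W * v₀ ≤ δ := (mul_le_mul_of_nonneg_right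
    (pow_le_pow_of_le_one hρ₀ hρ₁ (by omega)) hv₀).trans hδv
  have hRv : R * v₀ ≤ δ := (mul_le_mul_of_nonneg_right
    (pow_le_pow_of_le_one hρ₀ hρ₁ (by omega)) hv₀).trans hδv
  have hVv : V * v₀ ≤ δ := (mul_le_mul_of_nonneg_right
    (pow_le_pow_of_le_one hρ₀ hρ₁ (by omega)) hv₀).trans hδv
  have hVv2 : V * v₀ ^ 2 ≤ δ ^ 2 := by
    have h : V * v₀ ^ 2 = (ρ ^ j * v₀) ^ 2 := by rw [hV, mul_comm 2 j, pow_mul]; ring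
    rw [h]
    exact pow_le_pow_left₀ (by positivity) hδv 2
  have e1 : -(2 * √n * M ^ 2) ≤ W * L₁ := by
    have h : v₃ * (√n * v₁) ≤ M * (√n * M) := by gcongr
    have h' : W * (v₃ * (√n * v₁)) ≤ 1 * (M * (√n * M)) := by gcongr
    have := mul_le_mul_of_nonneg_left hL₁ hW0
    nlinarith [mul_nonneg hW0 (sq_nonneg v₂)]
  have e2 : 2 * (W * v₁ ^ 2) - 2 * √n * (M * δ) ≤ W * L₀ := by
    have h : v₂ * (√n * (W * v₀)) ≤ M * (√n * δ) := by gcongr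
    have := mul_le_mul_of_nonneg_left hL₀ hW0
    linarith
  -- This factor is `Δ(ρ^{2j+2})`; the coefficients add up as `q + q (q - 1) = q ^ 2`.
  have eLW : |((2 * j : ℕ) + 2) * R * Lρ + ((2 * j : ℕ) + 2) * ((2 * j : ℕ) + 1) * V * Gρ|
      ≤ q ^ 2 * b * V := by
    push_cast
    have h1 : |(2 * (j : ℝ) + 2) * R * Lρ| ≤ q * V * b := by
      rw [abs_mul, abs_of_nonneg (by positivity)]
      gcongr
    have h2 : |(2 * (j : ℝ) + 2) * (2 * j + 1) * V * Gρ| ≤ q * (q - 1) * V * b := by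
      rw [abs_of_nonneg (by positivity)]
      have : q - 1 = 2 * j + 1 := by rw [hq]; ring
      rw [this]
      gcongr
    refine (abs_add_le _ _).trans ((add_le_add h1 h2).trans (le_of_eq ?_))
    ring
  set LW := ((2 * j : ℕ) + 2) * R * Lρ + ((2 * j : ℕ) + 2) * ((2 * j : ℕ) + 1) * V * Gρ
  have e3 : -(q ^ 2 * b * M ^ 2) ≤ v₁ ^ 2 * LW := by
    have h : v₁ ^ 2 * (q ^ 2 * b * V) ≤ M ^ 2 * (q ^ 2 * b * 1) := by gcongr
    have := mul_le_mul_of_nonneg_left (abs_le.1 eLW).1 (sq_nonneg v₁)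
    linarith
  have e4 : -(q ^ 2 * b * (M * δ)) ≤ v₀ ^ 2 * LW := by
    have h : v₀ * (q ^ 2 * b) * (V * v₀) ≤ M * (q ^ 2 * b) * δ := by gcongr
    have := mul_le_mul_of_nonneg_left (abs_le.1 eLW).1 (sq_nonneg v₀)
    linarith
  have e5 : -(4 * q * √b * M ^ 2) ≤ 2 * (q * R * g₁) := by
    have h : q * R * (2 * (√Gρ * v₁ * v₂)) ≤ q * 1 * (2 * (√b * M * M)) := by gcongr
    have := mul_le_mul_of_nonneg_left (neg_le_of_abs_le hg₁)
      (show 0 ≤ q * R by positivity)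
    linarith
  have e6 : -(4 * q * √b * (M * δ)) ≤ 2 * (q * R * g₀) := by
    have h : q * (2 * (√Gρ * (R * v₀) * v₁)) ≤ q * (2 * (√b * δ * M)) := by gcongr
    have := mul_le_mul_of_nonneg_left (neg_le_of_abs_le hg₀)
      (show 0 ≤ q * R by positivity)
    linarith
  have hqc : ((2 * j + 2 : ℕ) : ℝ) = q := by rw [hq]; push_cast; ring
  rw [hqc] at hmax
  have e2' := mul_le_mul_of_nonneg_left e2 hl0.le
  have e4' := mul_le_mul_of_nonneg_left e4 hl0.le
  have e6' := mul_le_mul_of_nonneg_left e6 hl0.le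
  have hlMδ : l * (M * δ) = M ^ 2 := by rw [mul_left_comm, hlδ]; ring
  -- Each of the three kinds of error occurs twice, once without `l` and once with `l` and a factor
  -- `v₀`. The coefficient 2 of the good term halves the total, which gives `stepConst`.
  have main : l * (W * v₁ ^ 2) ≤ stepConst n j b * M ^ 2 := by
    rw [stepConst, ← hq]
    rw [show l * (2 * (W * v₁ ^ 2) - 2 * √n * (M * δ))
      = 2 * (l * (W * v₁ ^ 2)) - 2 * √n * (l * (M * δ)) by ring, hlMδ] at e2'
    rw [show l * -(q ^ 2 * b * (M * δ)) = -(q ^ 2 * b * (l * (M * δ))) by ring, hlMδ] at e4'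
    rw [show l * -(4 * q * √b * (M * δ)) = -(4 * q * √b * (l * (M * δ))) by ring, hlMδ] at e6'
    linarith only [hmax, e1, e2', e3, e4', e5, e6']
  have m1 : W * v₁ ^ 2 ≤ stepConst n j b * M * δ := by
    refine le_of_mul_le_mul_left (main.trans (le_of_eq ?_)) hl0
    rw [← hlMδ]
    ring
  -- The zeroth-order part of `F` accounts for the `+ 1` beside `stepConst`.
  have m2 : l * (W * v₀ ^ 2) ≤ M * δ := by
    have h : W * v₀ ^ 2 ≤ δ ^ 2 := (mul_le_mul_of_nonneg_right hWV (sq_nonneg v₀)).trans hVv2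
    refine (mul_le_mul_of_nonneg_left h hl0.le).trans (le_of_eq ?_)
    rw [← hlδ]
    ring
  linarith

/-! ### From the inequality at a maximum to the estimate on the manifold -/

section

variable {n : ℕ} {X : Type*} [TopologicalSpace X] [ChartedSpace (Model n) X]
  [IsManifold (𝓡 n) ∞ X] {r s : ℕ}

theorem covDerivNorm_nonneg (g : Metric n X) (η : SmoothTensorField n X r s) (k : ℕ) (x : X) :
    0 ≤ covDerivNorm g η k x := Real.sqrt_nonneg _

theorem smoothComp_tensorComp {φ : OpenPartialHomeomorph X (Model n)}
    (hφ : φ ∈ atlas (Model n) X) (η : SmoothTensorField n X r s) :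
    SmoothComp (tensorComp φ η.toFun) φ.target :=
  fun I J => η.smooth φ hφ I J

/-- The defining chart changes from point to point; chart independence lets one fixed chart serve a
whole neighbourhood. -/
theorem continuous_covDerivNorm (g : Metric n X) (η : SmoothTensorField n X r s) (k : ℕ) :
    Continuous (covDerivNorm g η k) := by
  rw [continuous_iff_continuousAt]
  intro x
  have hφ := chart_mem_atlas (Model n) x
  have hx := mem_chart_source (Model n) x
  set φ := chartAt (Model n) x
  have h1 : covDerivNorm g η k =ᶠ[𝓝 x]
      fun z => √(compNormSq φ g (iterCovDeriv φ g (tensorComp φ η.toFun) k) (φ z)) := by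
    filter_upwards [φ.open_source.mem_nhds hx] with z hz
    exact covDerivNorm_eq hφ g η k hz
  refine ContinuousAt.congr ?_ h1.symm
  have h2 := contDiffOn_compNormSq hφ g ((smoothComp_tensorComp hφ η).iterCovDeriv hφ g k)
  exact ((h2.continuousOn.continuousAt (φ.open_target.mem_nhds (φ.map_source hx))).comp
    (φ.continuousAt hx)).sqrt

theorem compGradNormSq_nonneg {φ : OpenPartialHomeomorph X (Model n)}
    (hφ : φ ∈ atlas (Model n) X) (g : Metric n X) {y : Model n} (hy : y ∈ φ.target)
    (f : Model n → ℝ) : 0 ≤ compGradNormSq φ g f y := by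
  have h := (gramInv_posSemidef hφ g hy).dotProduct_mulVec_nonneg fun i => pderiv i f y
  refine h.trans (le_of_eq ?_)
  simp only [compGradNormSq, dotProduct, Matrix.mulVec, Finset.mul_sum, star_trivial]
  exact Finset.sum_congr rfl fun i _ => Finset.sum_congr rfl fun j _ => by ring

/-- The estimate at an interior maximum of `ρ^{2j+2} (|∇^{j+1}η|² + (M / δ) |∇ʲη|²)`. -/
theorem bound_of_isLocalMax (g : Metric n X) (η : SmoothTensorField n X r s) {ρ : X → ℝ}
    (hρ : ContMDiff (𝓡 n) 𝓘(ℝ, ℝ) ∞ ρ) {x : X} (hρ₀ : 0 ≤ ρ x) (hρ₁ : ρ x ≤ 1) {b M δ : ℝ}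
    (hM : 0 < M) (hδ : 0 < δ) (hb : gradNormSq g ρ x + |laplacian g ρ x| ≤ b) (j : ℕ)
    (hv : ∀ i ≤ j + 3, covDerivNorm g η i x ≤ M) (hj : ρ x ^ j * covDerivNorm g η j x ≤ δ)
    (hmax : IsLocalMax (fun z => ρ z ^ (2 * j + 2) *
      (covDerivNorm g η (j + 1) z ^ 2 + M / δ * covDerivNorm g η j z ^ 2)) x) :
    ρ x ^ (2 * j + 2) * (covDerivNorm g η (j + 1) x ^ 2 + M / δ * covDerivNorm g η j x ^ 2)
      ≤ (stepConst n j b + 1) * M * δ := by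
  have hφ := chart_mem_atlas (Model n) x
  have hx := mem_chart_source (Model n) x
  -- The chart is the preferred one at the maximum point, so for `ρ` the bound holds by definition
  -- and no chart independence is needed.
  have hGL : compGradNormSq (chartAt (Model n) x) g (ρ ∘ (chartAt (Model n) x).symm)
      (chartAt (Model n) x x) + |compLaplacian (chartAt (Model n) x) g
      (ρ ∘ (chartAt (Model n) x).symm) (chartAt (Model n) x x)| ≤ b := hb
  set φ := chartAt (Model n) x
  set y := φ x with hy'
  have hy : y ∈ φ.target := φ.map_source hx
  have hyx : φ.symm y = x := φ.left_inv hx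
  set f : Model n → ℝ := ρ ∘ φ.symm
  have hfy : f y = ρ x := by rw [← hyx]; rfl
  have hf : ContDiffOn ℝ ∞ f φ.target := by
    rw [← contMDiffOn_iff_contDiffOn]
    exact hρ.comp_contMDiffOn (contMDiffOn_symm_of_mem_maximalAtlas (mem_maximalAtlas hφ))
  set D : (k : ℕ) → CompField n r (s + k) := iterCovDeriv φ g (tensorComp φ η.toFun) with hD
  have hDs : ∀ k, SmoothComp (D k) φ.target := (smoothComp_tensorComp hφ η).iterCovDeriv hφ g
  have hN : ∀ k, ContDiffOn ℝ ∞ (compNormSq φ g (D k)) φ.target :=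
    fun k => contDiffOn_compNormSq hφ g (hDs k)
  have hcov : ∀ k, ∀ z ∈ φ.target,
      covDerivNorm g η k (φ.symm z) ^ 2 = compNormSq φ g (D k) z := by
    intro k z hz
    rw [covDerivNorm_eq hφ g η k (φ.map_target hz), φ.right_inv hz,
      Real.sq_sqrt (compNormSq_nonneg hφ g hz _)]
  have hsq : ∀ k, √(compNormSq φ g (D k) y) = covDerivNorm g η k x := by
    intro k
    rw [← hcov k y hy, hyx, Real.sqrt_sq (covDerivNorm_nonneg g η k x)]
  have hsq' : ∀ k, compNormSq φ g (D k) y = covDerivNorm g η k x ^ 2 := by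
    intro k
    rw [← hcov k y hy, hyx]
  have hd : ∀ {F : Model n → ℝ}, ContDiffOn ℝ ∞ F φ.target → DifferentiableAt ℝ F y :=
    fun hF => differentiableAt_of_contDiffOn φ.open_target hF hy
  set Q : Model n → ℝ := fun z => compNormSq φ g (D (j + 1)) z + M / δ * compNormSq φ g (D j) z
  have hQ : ContDiffOn ℝ ∞ Q φ.target := (hN _).add (contDiffOn_const.mul (hN _))
  have hlm : IsLocalMax (fun z => f z ^ (2 * j + 2) * Q z) y := by
    have h1 : ∀ᶠ z in 𝓝 y, ρ (φ.symm z) ^ (2 * j + 2) *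
        (covDerivNorm g η (j + 1) (φ.symm z) ^ 2 + M / δ * covDerivNorm g η j (φ.symm z) ^ 2)
        ≤ ρ x ^ (2 * j + 2) *
        (covDerivNorm g η (j + 1) x ^ 2 + M / δ * covDerivNorm g η j x ^ 2) := by
      have hc := φ.symm.continuousAt (x := y) hy
      rw [ContinuousAt, hyx] at hc
      exact hc.eventually hmax
    filter_upwards [h1, φ.open_target.mem_nhds hy] with z hz hzt
    simp only [Q, hsq', hfy, ← hcov _ z hzt]
    exact hz
  have hlap := compLaplacian_nonpos_of_isLocalMax hφ g hy φ.open_target hy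
    ((hf.pow (2 * j + 2)).mul hQ) hlm
  rw [compLaplacian_mul φ g φ.open_target hy (hf.pow _) hQ,
    compLaplacian_add_const_mul φ g φ.open_target hy (hN _) (hN _),
    compLaplacian_pow φ g φ.open_target hy hf, gradInner_pow φ g (hd hf),
    gradInner_add_const_mul φ g (hd (hN _)) (hd (hN _))] at hlap
  simp only [Q, hsq', hfy] at hlap
  have hL := fun k => le_compLaplacian_compNormSq hφ g hy (hDs k)
  have hG := fun k => abs_gradInner_compNormSq_le hφ g hy (hDs k) (f := f)
  have hDD : ∀ k, covDeriv φ g (D k) = D (k + 1) := fun _ => rfl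
  have hL0 := hL j
  have hL1 := hL (j + 1)
  have hG0 := hG j
  have hG1 := hG (j + 1)
  rw [hDD j, hDD (j + 1), hsq, hsq, hsq'] at hL0
  rw [hDD (j + 1), hDD (j + 1 + 1), hsq, hsq, hsq'] at hL1
  rw [hDD j, hsq, hsq] at hG0
  rw [hDD (j + 1), hsq, hsq] at hG1
  exact interpolation_arith hρ₀ hρ₁ hM hδ (covDerivNorm_nonneg g η j x)
    (covDerivNorm_nonneg g η (j + 1) x) (covDerivNorm_nonneg g η (j + 2) x)
    (covDerivNorm_nonneg g η (j + 3) x) (hv _ (by omega)) (hv _ (by omega)) (hv _ (by omega))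
    (hv _ (by omega)) hj hL1 hL0 (compGradNormSq_nonneg hφ g hy f) hGL hG1 hG0 hlap

/-- Smallness of `∇ʲη` and bounds on the next derivatives imply smallness of `∇^{j+1}η`. -/
theorem interpolation_step [T2Space X] (g : Metric n X) (η : SmoothTensorField n X r s)
    {K U : Set X} {ρ : X → ℝ} (hρ : IsCutoff (n := n) K U ρ) {b M δ : ℝ} (hM : 0 < M) (hδ : 0 < δ)
    (hb₀ : 0 ≤ b)
    (hb : ∀ x ∈ tsupport ρ, gradNormSq g ρ x + |laplacian g ρ x| ≤ b) (j : ℕ)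
    (hv : ∀ i ≤ j + 3, ∀ x ∈ tsupport ρ, covDerivNorm g η i x ≤ M)
    (hj : ∀ x ∈ tsupport ρ, ρ x ^ j * covDerivNorm g η j x ≤ δ) :
    ∀ x ∈ tsupport ρ, ρ x ^ (j + 1) * covDerivNorm g η (j + 1) x
      ≤ √((stepConst n j b + 1) * M * δ) := by
  intro x hx
  let F : X → ℝ := fun z => ρ z ^ (2 * j + 2) *
      (covDerivNorm g η (j + 1) z ^ 2 + M / δ * covDerivNorm g η j z ^ 2)
  have hρc : Continuous ρ := hρ.smooth.continuous
  have hF : Continuous F := (hρc.pow _).mul (((continuous_covDerivNorm g η (j + 1)).pow 2).add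
    (continuous_const.mul ((continuous_covDerivNorm g η j).pow 2)))
  have hC := stepConst_nonneg n j hb₀
  obtain ⟨x₀, hx₀, hmax⟩ := IsCompact.exists_isMaxOn hρ.compact ⟨x, hx⟩ hF.continuousOn
  have hF0 : F x₀ ≤ (stepConst n j b + 1) * M * δ := by
    -- A maximum over the support at a zero of `ρ` forces `F = 0` there. Otherwise `ρ` is nonzero
    -- near `x₀`, so the maximum is a local one in `X`.
    by_cases h0 : ρ x₀ = 0
    · simp only [F, h0]
      rw [zero_pow (by omega), zero_mul]
      positivity
    · refine bound_of_isLocalMax g η hρ.smooth (hρ.nonneg x₀) (hρ.le_one x₀) hM hδ (hb x₀ hx₀) j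
        (fun i hi => hv i hi x₀ hx₀) (hj x₀ hx₀) ?_
      have hs : Function.support ρ ∈ 𝓝 x₀ := hρc.isOpen_support.mem_nhds h0
      filter_upwards [hs] with z hz
      exact hmax (subset_tsupport ρ hz)
  refine Real.le_sqrt_of_sq_le (le_trans ?_ ((hmax hx).trans hF0))
  change (ρ x ^ (j + 1) * covDerivNorm g η (j + 1) x) ^ 2 ≤ F x
  have h1 : 0 ≤ ρ x ^ (2 * j + 2) * (M / δ * covDerivNorm g η j x ^ 2) := by
    have := hρ.nonneg x
    positivity
  have h2 : (ρ x ^ (j + 1) * covDerivNorm g η (j + 1) x) ^ 2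
      = ρ x ^ (2 * j + 2) * covDerivNorm g η (j + 1) x ^ 2 := by ring
  rw [h2]
  simp only [F, mul_add]
  linarith

/-! ### The bounds -/

/-- Bounds for `|∇ʲη|`, given the bound `d` for `|η|`, the bound `M` for the derivatives and the
bound `b` for the cut-off function. -/
def interpBound (n : ℕ) (b M d : ℝ) : ℕ → ℝ
  | 0 => d
  | j + 1 => √((stepConst n j b + 1) * M * interpBound n b M d j)

theorem interpBound_pos (n : ℕ) {b M d : ℝ} (hb : 0 ≤ b) (hM : 0 < M) (hd : 0 < d) :
    ∀ j, 0 < interpBound n b M d j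
  | 0 => hd
  | j + 1 => by
    have h1 := interpBound_pos n hb hM hd j
    have h2 := stepConst_nonneg n j hb
    rw [interpBound]
    positivity

/-- The square root is continuous at zero, and `b` and `M` do not depend on `t`. -/
theorem tendsto_interpBound (n : ℕ) (b M : ℝ) {h₀ : ℝ → ℝ}
    (h : Filter.Tendsto h₀ Filter.atTop (𝓝 0)) :
    ∀ j, Filter.Tendsto (fun t => interpBound n b M (h₀ t) j) Filter.atTop (𝓝 0)
  | 0 => h
  | j + 1 => by
    have h1 := ((tendsto_interpBound n b M h j).const_mul ((stepConst n j b + 1) * M)).sqrt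
    rw [mul_zero, Real.sqrt_zero] at h1
    exact h1

/-- The weight `ρ ^ j` makes the output of one step the input of the next without changing the
cut-off. The step to `j + 1 ≤ k` uses derivatives up to `j + 3 ≤ k + 2`. -/
theorem interpBound_spec [T2Space X] (g : Metric n X) (η : SmoothTensorField n X r s)
    {K U : Set X} {ρ : X → ℝ} (hρ : IsCutoff (n := n) K U ρ) {b M d : ℝ} (hM : 0 < M) (hd : 0 < d)
    (hb₀ : 0 ≤ b) (hb : ∀ x ∈ tsupport ρ, gradNormSq g ρ x + |laplacian g ρ x| ≤ b) (k : ℕ)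
    (hv : ∀ i ≤ k + 2, ∀ x ∈ tsupport ρ, covDerivNorm g η i x ≤ M)
    (h0 : ∀ x ∈ tsupport ρ, covDerivNorm g η 0 x ≤ d) :
    ∀ j ≤ k, ∀ x ∈ tsupport ρ, ρ x ^ j * covDerivNorm g η j x ≤ interpBound n b M d j
  | 0, _ => fun x hx => by
    rw [pow_zero, one_mul]
    exact h0 x hx
  | j + 1, hj => interpolation_step g η hρ hM (interpBound_pos n hb₀ hM hd j) hb₀ hb j
      (fun i hi => hv i (by omega))
      (interpBound_spec g η hρ hM hd hb₀ hb k hv h0 j (by omega))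

theorem covDerivNorm_le_of_ckNorm_le {g : Metric n X} {η : SmoothTensorField n X r s} {k : ℕ}
    {S : Set X} {A : ℝ} (hA : 0 ≤ A) (h : ckNorm k S g η ≤ ENNReal.ofReal A) {j : ℕ} (hj : j ≤ k)
    {x : X} (hx : x ∈ S) : covDerivNorm g η j x ≤ A := by
  rw [← ENNReal.ofReal_le_ofReal_iff hA]
  refine le_trans ?_ h
  refine le_trans ?_ (Finset.single_le_sum
    (f := fun j => ⨆ x ∈ S, ENNReal.ofReal (covDerivNorm g η j x)) (fun _ _ => zero_le)
    (Finset.mem_range.2 (Nat.lt_succ_of_le hj)))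
  exact le_iSup₂ (f := fun x (_ : x ∈ S) => ENNReal.ofReal (covDerivNorm g η j x)) x hx

theorem ckNorm_le_of_covDerivNorm_le {g : Metric n X} {η : SmoothTensorField n X r s} {k : ℕ}
    {S : Set X} {c : ℕ → ℝ} (hc : ∀ j, 0 ≤ c j)
    (h : ∀ j ≤ k, ∀ x ∈ S, covDerivNorm g η j x ≤ c j) :
    ckNorm k S g η ≤ ENNReal.ofReal (∑ j ∈ Finset.range (k + 1), c j) := by
  rw [ENNReal.ofReal_sum_of_nonneg fun j _ => hc j]
  refine Finset.sum_le_sum fun j hj => iSup₂_le fun x hx => ENNReal.ofReal_le_ofReal ?_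
  exact h j (Nat.lt_succ_iff.1 (Finset.mem_range.1 hj)) x hx

theorem ckNorm_mono {g : Metric n X} {η : SmoothTensorField n X r s} (k : ℕ)
    {S S' : Set X} (h : S ⊆ S') : ckNorm k S g η ≤ ckNorm k S' g η :=
  Finset.sum_le_sum fun _ _ => biSup_mono fun _ hx => h hx

end

/-- A bound for all the derivatives up to order `k + 2`. -/
def derivBound {m : ℕ} (a : Fin m → ℝ) : ℝ := 1 + ∑ i, a i

theorem derivBound_pos {m : ℕ} {a : Fin m → ℝ} (ha : ∀ i, 0 < a i) : 0 < derivBound a :=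
  add_pos_of_pos_of_nonneg one_pos (Finset.sum_nonneg fun i _ => (ha i).le)

theorem le_derivBound {m : ℕ} {a : Fin m → ℝ} (ha : ∀ i, 0 < a i) (i : Fin m) :
    a i ≤ derivBound a := by
  have := Finset.single_le_sum (fun i _ => (ha i).le) (Finset.mem_univ i)
  rw [derivBound]
  linarith

/-- The functions `H_k(a₁, …, a_{k+2}; b; h₀)`. -/
def convergenceBound (n k : ℕ) (a : Fin (k + 2) → ℝ) (b : ℝ) (h₀ : ℝ → ℝ) (t : ℝ) : ℝ :=
  -- For negative times the cut-off bound is not available, and only the limit at `+∞` matters.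
  -- Below, `|b|` keeps the value positive for every real `b`.
  if t < 0 then h₀ t + derivBound a
  else ∑ j ∈ Finset.range (k + 1), interpBound n |b| (derivBound a) (h₀ t) j

theorem convergenceBound_pos (n k : ℕ) {a : Fin (k + 2) → ℝ} (b : ℝ) {h₀ : ℝ → ℝ}
    (ha : ∀ i, 0 < a i) (hh : ∀ t, 0 < h₀ t) (t : ℝ) : 0 < convergenceBound n k a b h₀ t := by
  rw [convergenceBound]
  split_ifs
  · exact add_pos (hh t) (derivBound_pos ha)
  · exact Finset.sum_pos (fun j _ => interpBound_pos n (abs_nonneg b) (derivBound_pos ha) (hh t) j)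
      (by simp)

theorem tendsto_convergenceBound (n k : ℕ) (a : Fin (k + 2) → ℝ) (b : ℝ) {h₀ : ℝ → ℝ}
    (hlim : Filter.Tendsto h₀ Filter.atTop (𝓝 0)) :
    Filter.Tendsto (convergenceBound n k a b h₀) Filter.atTop (𝓝 0) := by
  have h1 := tendsto_finsetSum (Finset.range (k + 1)) fun j _ =>
    tendsto_interpBound n |b| (derivBound a) hlim j
  rw [Finset.sum_const_zero] at h1
  refine h1.congr' ?_
  filter_upwards [Filter.eventually_ge_atTop 0] with t ht
  rw [convergenceBound, if_neg (not_lt.2 ht)]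

end BIC

end

/-! ### The main theorem -/

theorem lemma1p1 (n r s : ℕ) :
    -- the bounds `H k (A₁, …, A_{k+2}) B_K h₀`, which depend on nothing else (but `n, r, s`)
    ∃ H : (k : ℕ) → (Fin (k + 2) → ℝ) → ℝ → (ℝ → ℝ) → (ℝ → ℝ),
      (∀ (k : ℕ) (a : Fin (k + 2) → ℝ) (b : ℝ) (h₀ : ℝ → ℝ), (∀ i, 0 < a i) → (∀ t, 0 < h₀ t) →
        Filter.Tendsto h₀ Filter.atTop (𝓝 0) →
          (∀ t, 0 < H k a b h₀ t) ∧ Filter.Tendsto (H k a b h₀) Filter.atTop (𝓝 0)) ∧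
      ∀ (X : Type u) [TopologicalSpace X] [T2Space X] [ChartedSpace (BIC.Model n) X]
        [IsManifold (𝓡 n) ∞ X] (U : Set X) (g : ℝ → BIC.Metric n X)
        (η : ℝ → BIC.SmoothTensorField n X r s)
        (A : ℕ → ℝ) (h₀ : ℝ → ℝ) (B : Set X → ℝ),
        IsOpen U → (∀ k, 1 ≤ k → 0 < A k) → (∀ t, 0 < h₀ t) →
        Filter.Tendsto h₀ Filter.atTop (𝓝 0) →
        -- (A)
        (∀ t, BIC.ckNorm 0 U (g t) (η t) ≤ ENNReal.ofReal (h₀ t)) →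
        -- (B)
        (∀ k, 1 ≤ k → ∀ t, BIC.ckNorm k U (g t) (η t) ≤ ENNReal.ofReal (A k)) →
        -- (C)
        (∀ K, IsCompact K → K ⊆ U → ∃ ρ : X → ℝ, BIC.IsCutoff (n := n) K U ρ ∧
          ∀ t, 0 ≤ t → ∀ x ∈ tsupport ρ,
            BIC.gradNormSq (g t) ρ x + |BIC.laplacian (g t) ρ x| ≤ B K) →
        ∀ K, IsCompact K → K ⊆ U → ∀ (k : ℕ) (t : ℝ),
          BIC.ckNorm k K (g t) (η t) ≤
            ENNReal.ofReal (H k (fun i => A (i + 1)) (B K) h₀ t) := by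
  refine ⟨BIC.convergenceBound n, fun k a b h₀ ha hh hlim =>
    ⟨BIC.convergenceBound_pos n k b ha hh, BIC.tendsto_convergenceBound n k a b hlim⟩, ?_⟩
  intro X _ _ _ _ U g η A h₀ B _ hA hh _ h0 hB hC K hK hKU k t
  have ha : ∀ i : Fin (k + 2), 0 < A (i + 1) := fun i => hA _ (by omega)
  have hM := BIC.derivBound_pos ha
  have hle : ∀ i, i ≤ k + 2 → 1 ≤ i → A i ≤ BIC.derivBound fun i : Fin (k + 2) => A (i + 1) := by
    intro i hi hi1
    have := BIC.le_derivBound ha ⟨i - 1, by omega⟩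
    rwa [show ((⟨i - 1, by omega⟩ : Fin (k + 2)) : ℕ) + 1 = i from Nat.sub_add_cancel hi1] at this
  rw [BIC.convergenceBound]
  split_ifs with ht
  -- At negative times (A) and (B) on `U` suffice: (A) for order zero, (B) otherwise.
  · refine (BIC.ckNorm_mono k hKU).trans ?_
    rcases Nat.eq_zero_or_pos k with rfl | hk
    · exact (h0 t).trans (ENNReal.ofReal_le_ofReal (by linarith))
    · refine (hB k hk t).trans (ENNReal.ofReal_le_ofReal ?_)
      have := hle k (by omega) hk
      linarith [hh t]
  · obtain ⟨ρ, hρ, hρb⟩ := hC K hK hKU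
    have hb : ∀ x ∈ tsupport ρ, BIC.gradNormSq (g t) ρ x + |BIC.laplacian (g t) ρ x| ≤ |B K| :=
      fun x hx => (hρb t (not_lt.1 ht) x hx).trans (le_abs_self _)
    have hv : ∀ i ≤ k + 2, ∀ x ∈ tsupport ρ, BIC.covDerivNorm (g t) (η t) i x
        ≤ BIC.derivBound fun i : Fin (k + 2) => A (i + 1) := by
      intro i hi x hx
      rcases Nat.eq_zero_or_pos i with rfl | hi1
      -- Order zero is bounded by `A 1`, since the `C¹` norm contains the `C⁰` norm; thus `M` does
      -- not depend on `t` through `h₀`.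
      · exact (BIC.covDerivNorm_le_of_ckNorm_le (hA 1 le_rfl).le (hB 1 le_rfl t) (Nat.zero_le 1)
          (hρ.subset hx)).trans (hle 1 (by omega) le_rfl)
      · exact (BIC.covDerivNorm_le_of_ckNorm_le (hA i hi1).le (hB i hi1 t) le_rfl
          (hρ.subset hx)).trans (hle i hi hi1)
    have hv0 : ∀ x ∈ tsupport ρ, BIC.covDerivNorm (g t) (η t) 0 x ≤ h₀ t := fun x hx =>
      BIC.covDerivNorm_le_of_ckNorm_le (hh t).le (h0 t) le_rfl (hρ.subset hx)
    refine BIC.ckNorm_le_of_covDerivNorm_le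
      (fun j => (BIC.interpBound_pos n (abs_nonneg _) hM (hh t) j).le) fun j hj x hx => ?_
    -- On `K` the weights `ρ ^ j` disappear.
    have hx1 : ρ x = 1 := hρ.eq_one.self_of_nhdsSet x hx
    have hxs : x ∈ tsupport ρ := subset_tsupport ρ (by simp [hx1])
    have := BIC.interpBound_spec (g t) (η t) hρ hM (hh t) (abs_nonneg _) hb k hv hv0 j hj x hxs
    rwa [hx1, one_pow, one_mul] at this
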